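/- **Setting.** Let $\Gamma^0\subset\mathbb{R}^3$ be a smooth closed (compact, embedded, without boundary) surface, $T>0$, and let $X:\Gamma^0\times[0,T]\to\mathbb{R}^3$ be smooth with $X(q,0)=q$, such that for every $t\in[0,T]$ the map $X(\cdot,t)$ is injective with injective differential on the tangent planes of $\Gamma^0$; thus $\Gamma(t)=X(\Gamma^0,t)$ is a smoothly evolving family of smooth closed surfaces. Let $k\ge 1$ (polynomial degree) and $p\ge 1$ (number of steps). A triangulation of $\Gamma^0$ is given by a conforming polyhedral surface of non-degenerate flat triangles with vertices on $\Gamma^0$, on which the closest point projection onto $\Gamma^0$ is well defined and is a bijection onto $\Gamma^0$. Its nodes $q_1,\dots,q_N\in\Gamma^0$ are the closest point projections of the Lagrange points of degree $k$ of the flat triangles. The mesh width $h$ is the maximal diameter of the flat triangles. A family of triangulations is admissible if there is a constant $\sigma$ such that for all its members every triangle has diameter at most $\sigma$ times its inradius (shape regularity) and at least $h/\sigma$ (quasi-uniformity). A nodal vector $\mathbf{x}=(x_1,\dots,x_N)\in(\mathbb{R}^3)^N$ defines the piecewise polynomial surface $\Gamma_h[\mathbf{x}]$: on each element it is parametrized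 over the plane reference triangle by the polynomial of degree $k$ that takes the values $x_j$ at the Lagrange points. The basis functions $\phi_j[\mathbf{x}]$, $j=1,\dots,N$, are those whose pullbacks to the reference triangle are, on every element, polynomials of degree $k$ and which equal $1$ at the $j$th node and $0$ at all other nodes. With integrals and tangential gradients taken elementwise through these parametrizations, set $$ \mathbf{M}(\mathbf{x})_{ij}=\int_{\Gamma_h[\mathbf{x}]}\phi_i[\mathbf{x}]\,\phi_j[\mathbf{x}],\qquad \mathbf{A}(\mathbf{x})_{ij}=\int_{\Gamma_h[\mathbf{x}]}\nabla_{\Gamma_h[\mathbf{x}]}\phi_i[\mathbf{x}]\cdot\nabla_{\Gamma_h[\mathbf{x}]}\phi_j[\mathbf{x}], $$ $$ \mathbf{K}(\mathbf{x})=I_3\otimes\mathbf{M}(\mathbf{x})+\alpha\, I_3\otimes\mathbf{A}(\mathbf{x})\quad(\alpha\ge 0), $$ and $\|\mathbf{w}\|_{\mathbf{B}}=(\mathbf{w}^T\mathbf{B}\mathbf{w})^{1/2}$ for a positive semidefinite matrix $\mathbf{B}$. For a step size $\tau>0$ and an integer $n\ge p$ with $n\tau\le T$ write $t_m=m\tau$,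 and let $\mathbf{x}_*^m=(X(q_j,t_m))_{j=1}^N$ and $$ \widetilde{\mathbf{x}}_*^n=\sum_{j=0}^{p-1}\gamma_j\,\mathbf{x}_*^{n-1-j},\qquad \sum_{j=0}^{p-1}\gamma_j\zeta^j=\frac{1-(1-\zeta)^p}{\zeta}. $$ **Lemma.** For every $\sigma$ there are constants $h_0>0$, $\tau_0>0$ and $C$, depending only on $\Gamma^0,X,T,k,p,\sigma$, such that for every triangulation as above that is admissible with the constant $\sigma$ and has $h\le h_0$, for all $\tau>0$ and all $n\ge p$ with $n\tau\le T$: (i) for all $\mathbf{w},\mathbf{z}\in\mathbb{R}^N$, $$ \mathbf{w}^T\bigl(\mathbf{M}(\widetilde{\mathbf{x}}_*^n)-\mathbf{M}(\mathbf{x}_*^n)\bigr)\mathbf{z}\le C\tau^p\,\|\mathbf{w}\|_{\mathbf{M}(\mathbf{x}_*^n)}\|\mathbf{z}\|_{\mathbf{M}(\mathbf{x}_*^n)}; $$ (ii) if $\tau\le\tau_0$, then for all $\mathbf{w},\mathbf{z}\in\mathbb{R}^N$, $$ \mathbf{w}^T\bigl(\mathbf{A}(\widetilde{\mathbf{x}}_*^n)-\mathbf{A}(\mathbf{x}_*^n)\bigr)\mathbf{z}\le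 C\tau^p\,\|\mathbf{w}\|_{\mathbf{A}(\mathbf{x}_*^n)}\|\mathbf{z}\|_{\mathbf{A}(\mathbf{x}_*^n)}; $$ (iii) if $\tau\le\tau_0$, then for all $\alpha\ge 0$ and all $\mathbf{w}\in\mathbb{R}^{3N}$, $$ \tfrac12\|\mathbf{w}\|_{\mathbf{K}(\mathbf{x}_*^n)}^2\le\|\mathbf{w}\|_{\mathbf{K}(\widetilde{\mathbf{x}}_*^n)}^2\le\tfrac32\|\mathbf{w}\|_{\mathbf{K}(\mathbf{x}_*^n)}^2 . $$ -/

import Mathlib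

open scoped ContDiff InnerProductSpace

noncomputable section

namespace ESFEM

/-- The ambient Euclidean space. -/
abbrev E3 : Type := EuclideanSpace ℝ (Fin 3)

/-- The plane that contains the reference triangle. -/
abbrev E2 : Type := EuclideanSpace ℝ (Fin 2)

/-! ### Smooth closed surfaces and their evolution -/

/-- A smooth closed surface in `ℝ³`: a compact set which near each of its points is a regular
level set of a smooth function (an embedded two-dimensional submanifold without boundary). -/
structure IsSmoothClosedSurface (Γ : Set E3) : Prop where
  isCompact : IsCompact Γ
  regular : ∀ x ∈ Γ, ∃ U : Set E3, IsOpen U ∧ x ∈ U ∧ ∃ f : E3 → ℝ,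
    ContDiffOn ℝ ∞ f U ∧ (∀ y ∈ U, fderiv ℝ f y ≠ 0) ∧ Γ ∩ U = {y ∈ U | f y = 0}

/-- `X : Γ⁰ × [0,T] → ℝ³` describes the smoothly evolving family of smooth closed surfaces
`Γ(t) = {X(q,t) : q ∈ Γ⁰}`: it is smooth, `X(q,0) = q`, and for every `t` the map `X(·,t)` is
injective and non-degenerate, that is, its differential is injective on the tangent planes of
`Γ⁰`. Only the values of `X` on `Γ⁰ × [0,T]` matter. -/
structure IsSmoothEvolution (Γ : Set E3) (T : ℝ) (X : E3 → ℝ → E3) : Prop where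
  smooth : ContDiffOn ℝ ∞ (fun z : E3 × ℝ => X z.1 z.2) (Γ ×ˢ Set.Icc 0 T)
  initial : ∀ q ∈ Γ, X q 0 = q
  injOn : ∀ t ∈ Set.Icc 0 T, Set.InjOn (fun q => X q t) Γ
  nondegenerate : ∀ t ∈ Set.Icc 0 T, ∀ q ∈ Γ, ∀ L : E3 →L[ℝ] E3,
    HasFDerivWithinAt (fun y => X y t) L Γ q → ∀ v ∈ tangentConeAt ℝ Γ q, L v = 0 → v = 0

/-! ### Lagrange elements of degree `k` on the reference triangle -/

/-- The unit reference triangle. -/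
def refTriangle : Set E2 := {ξ | 0 ≤ ξ 0 ∧ 0 ≤ ξ 1 ∧ ξ 0 + ξ 1 ≤ 1}

/-- Barycentric coordinates on the reference triangle. -/
def bary (ξ : E2) : Fin 3 → ℝ := ![1 - ξ 0 - ξ 1, ξ 0, ξ 1]

/-- The indices `a = (a₀,a₁,a₂)`, `a₀ + a₁ + a₂ = k`, of the Lagrange points of degree `k`; the
point with index `a` has the barycentric coordinates `a / k`. -/
abbrev LagrangeIndex (k : ℕ) : Type := {a : Fin 3 → Fin (k + 1) // ∑ i, (a i : ℕ) = k}

/-- The Lagrange basis polynomial of degree `k` that equals `1` at the Lagrange point with index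
`a` and `0` at all the other Lagrange points. -/
def lagrangeBasis (k : ℕ) (a : LagrangeIndex k) (ξ : E2) : ℝ :=
  ∏ i : Fin 3, ∏ m ∈ Finset.range (a.1 i : ℕ),
    ((k : ℝ) * bary ξ i - (m : ℝ)) / (((a.1 i : ℕ) : ℝ) - (m : ℝ))

/-! ### Triangulations -/

/-- The flat triangle with the given vertices. -/
def triangle (v : Fin 3 → E3) : Set E3 := convexHull ℝ (Set.range v)

/-- The radius of the inscribed circle, twice the area divided by the perimeter. -/
def inradius (v : Fin 3 → E3) : ℝ :=
  Real.sqrt (‖v 1 - v 0‖ ^ 2 * ‖v 2 - v 0‖ ^ 2 - ⟪v 1 - v 0, v 2 - v 0⟫_ℝ ^ 2) /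
    (dist (v 0) (v 1) + dist (v 1) (v 2) + dist (v 2) (v 0))

/-- `y` is a closest point of `Γ` to `x`. -/
def IsClosestPoint (Γ : Set E3) (x y : E3) : Prop := y ∈ Γ ∧ dist x y = Metric.infDist x Γ

/-- A triangulation of the surface `Γ` with the nodes of finite elements of degree `k`. It is given
by a conforming polyhedral surface of flat triangles with vertices on `Γ`, on which the closest
point projection is a well-defined bijection onto `Γ`. The nodes on `Γ` are the images under this
projection of the Lagrange points of degree `k` of the flat triangles; Lagrange points that are
shared by neighbouring triangles give one node. -/
structure Triangulation (Γ : Set E3) (k : ℕ) where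
  numElements : ℕ
  vertex : Fin numElements → Fin 3 → E3
  vertex_mem : ∀ e i, vertex e i ∈ Γ
  affineIndependent : ∀ e, AffineIndependent ℝ (vertex e)
  distinct : ∀ e e', Set.range (vertex e) = Set.range (vertex e') → e = e'
  conforming : ∀ e e', triangle (vertex e) ∩ triangle (vertex e') =
    convexHull ℝ (Set.range (vertex e) ∩ Set.range (vertex e'))
  existsUnique_closest : ∀ x ∈ ⋃ e, triangle (vertex e), ∃! y, IsClosestPoint Γ x y
  existsUnique_preimage : ∀ y ∈ Γ, ∃! x, x ∈ ⋃ e, triangle (vertex e) ∧ IsClosestPoint Γ x y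
  /-- The number `N` of nodes. -/
  numNodes : ℕ
  /-- The Lagrange points on the polyhedral surface. -/
  flatNode : Fin numNodes → E3
  flatNode_injective : Function.Injective flatNode
  /-- The global number of the Lagrange point with local index `a` on the element `e`. -/
  nodeIndex : Fin numElements → LagrangeIndex k → Fin numNodes
  flatNode_nodeIndex : ∀ e a,
    flatNode (nodeIndex e a) = ∑ i, (((a.1 i : ℕ) : ℝ) / (k : ℝ)) • vertex e i
  exists_nodeIndex : ∀ j, ∃ e a, nodeIndex e a = j
  /-- The nodes `q_j = x_j(0)` on `Γ`. -/
  node : Fin numNodes → E3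
  node_closest : ∀ j, IsClosestPoint Γ (flatNode j) (node j)

namespace Triangulation

variable {Γ : Set E3} {k : ℕ} (𝒯 : Triangulation Γ k)

/-- The mesh width `h`, the maximal diameter of the triangles. -/
def meshWidth : ℝ := ⨆ e, Metric.diam (triangle (𝒯.vertex e))

/-- Shape regularity and quasi-uniformity with the constant `σ`. A family of triangulations is
admissible if all its members satisfy this with one `σ`. -/
structure IsAdmissible (σ : ℝ) : Prop where
  shapeRegular : ∀ e, Metric.diam (triangle (𝒯.vertex e)) ≤ σ * inradius (𝒯.vertex e)
  quasiUniform : ∀ e, 𝒯.meshWidth ≤ σ * Metric.diam (triangle (𝒯.vertex e))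

/-! ### Finite element functions and surfaces

A nodal vector `x ∈ (ℝ³)^N` defines the surface `Γ_h[x]`: the element `e` is parametrized over the
reference triangle by the polynomial of degree `k` that takes the values `x_j` at the Lagrange
points. Functions on `Γ_h[x]` are given by their pullbacks to the reference triangle, one for each
element. -/

/-- The pullback, on the element `e`, of the finite element function with nodal values `w`. -/
def pullback {V : Type} [AddCommGroup V] [Module ℝ V] (w : Fin 𝒯.numNodes → V)
    (e : Fin 𝒯.numElements) (ξ : E2) : V :=
  ∑ a : LagrangeIndex k, lagrangeBasis k a ξ • w (𝒯.nodeIndex e a)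

/-- The pullback of the basis function `φ_j[x]`; it does not depend on `x`. -/
def basisFun (j : Fin 𝒯.numNodes) : Fin 𝒯.numElements → E2 → ℝ :=
  𝒯.pullback (Pi.single j (1 : ℝ))

/-- The tangent vector `∂F/∂ξ_i` of the parametrization `F` of the element `e` of `Γ_h[x]`. -/
def tangent (x : Fin 𝒯.numNodes → E3) (e : Fin 𝒯.numElements) (ξ : E2) (i : Fin 2) : E3 :=
  fderiv ℝ (𝒯.pullback x e) ξ (EuclideanSpace.single i (1 : ℝ))

/-- The first fundamental form of the parametrization of the element `e` of `Γ_h[x]`. -/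
def gram (x : Fin 𝒯.numNodes → E3) (e : Fin 𝒯.numElements) (ξ : E2) :
    Matrix (Fin 2) (Fin 2) ℝ :=
  Matrix.of fun i j => ⟪𝒯.tangent x e ξ i, 𝒯.tangent x e ξ j⟫_ℝ

/-- The tangential gradient on the element `e` of `Γ_h[x]` of the function with pullback `u`. -/
def tangentialGradient (x : Fin 𝒯.numNodes → E3) (e : Fin 𝒯.numElements) (u : E2 → ℝ)
    (ξ : E2) : E3 :=
  ∑ i : Fin 2, ∑ j : Fin 2,
    ((𝒯.gram x e ξ)⁻¹ i j * fderiv ℝ u ξ (EuclideanSpace.single j (1 : ℝ))) • 𝒯.tangent x e ξ i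

/-- The integral over `Γ_h[x]` of the function with the pullbacks `f e`. -/
def surfaceIntegral (x : Fin 𝒯.numNodes → E3) (f : Fin 𝒯.numElements → E2 → ℝ) : ℝ :=
  ∑ e, ∫ ξ in refTriangle, f e ξ * Real.sqrt (𝒯.gram x e ξ).det

/-- The mass matrix `M(x)`. -/
def massMatrix (x : Fin 𝒯.numNodes → E3) : Matrix (Fin 𝒯.numNodes) (Fin 𝒯.numNodes) ℝ :=
  Matrix.of fun i j => 𝒯.surfaceIntegral x fun e ξ => 𝒯.basisFun i e ξ * 𝒯.basisFun j e ξ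

/-- The stiffness matrix `A(x)`. -/
def stiffnessMatrix (x : Fin 𝒯.numNodes → E3) : Matrix (Fin 𝒯.numNodes) (Fin 𝒯.numNodes) ℝ :=
  Matrix.of fun i j => 𝒯.surfaceIntegral x fun e ξ =>
    ⟪𝒯.tangentialGradient x e (𝒯.basisFun i e) ξ, 𝒯.tangentialGradient x e (𝒯.basisFun j e) ξ⟫_ℝ

/-- The matrix `K(x) = I₃ ⊗ M(x) + α I₃ ⊗ A(x)`. -/
def kMatrix (α : ℝ) (x : Fin 𝒯.numNodes → E3) :
    Matrix (Fin 3 × Fin 𝒯.numNodes) (Fin 3 × Fin 𝒯.numNodes) ℝ :=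
  Matrix.kronecker (1 : Matrix (Fin 3) (Fin 3) ℝ) (𝒯.massMatrix x) +
    α • Matrix.kronecker (1 : Matrix (Fin 3) (Fin 3) ℝ) (𝒯.stiffnessMatrix x)

/-- The nodal vector `x_*(t)` of the exact positions `X(q_j,t)`. -/
def exactNodes (X : E3 → ℝ → E3) (t : ℝ) : Fin 𝒯.numNodes → E3 := fun j => X (𝒯.node j) t

end Triangulation

/-- The coefficients `γ_j` of the polynomial `γ(ζ) = (1 - (1 - ζ)^p) / ζ`. -/
def extrapolationCoeff (p j : ℕ) : ℝ :=
  (1 - (1 - (Polynomial.X : Polynomial ℝ)) ^ p).divX.coeff j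

/-- The extrapolated nodal vector `∑_{j<p} γ_j x_*(t_{n-1-j})`, where `t_m = m τ`. -/
def Triangulation.extrapolatedNodes {Γ : Set E3} {k : ℕ} (𝒯 : Triangulation Γ k)
    (X : E3 → ℝ → E3) (p : ℕ) (τ : ℝ) (n : ℕ) : Fin 𝒯.numNodes → E3 :=
  ∑ j ∈ Finset.range p,
    extrapolationCoeff p j • 𝒯.exactNodes X (((n : ℝ) - 1 - (j : ℝ)) * τ)

/-- The (semi)norm `‖w‖_B = (wᵀ B w)^{1/2}` induced by a positive semidefinite matrix `B`. -/
def matNorm {ι : Type} [Fintype ι] (B : Matrix ι ι ℝ) (w : ι → ℝ) : ℝ :=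
  Real.sqrt (dotProduct w (B.mulVec w))

end ESFEM

end

/-!
The proof compares the parametrizations of `Γ_h[x̃_*ⁿ]` and `Γ_h[x_*ⁿ]` element by element. On an
element of diameter `d` let `a₀, a₁` and `a'₀, a'₁` be the tangent vectors of the two
parametrizations over the reference triangle. Everything follows from the relative bound
`‖(α a'₀ + β a'₁) - (α a₀ + β a₁)‖ ≤ ε ‖α a₀ + β a₁‖` for all `α, β`, with `ε = E τ^p`
(`IsRelPerturbation`, established in `exists_relPerturbation_bound`).

*From the relative bound to the matrices.* A bound `‖α a'₀ + β a'₁‖ ≤ κ ‖α a₀ + β a₁‖` gives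
`area' ≤ κ² area`, so the area elements differ by `O(ε)` relatively (`abs_area_sub_le`). With
`u₀, u₁` the derivatives of a function on the reference triangle, the squared norm of its tangential
gradient times the area element is `‖u₁ a₀ - u₀ a₁‖² / area`, which needs no inverse of the
first fundamental form and differs by `O(ε)` relatively too (`abs_energyDensity_sub_le`).
Integration gives the estimates for quadratic forms, and polarization of the symmetric difference
matrices gives those for bilinear forms (`dotProduct_mulVec_le_of_quadratic`).

*The relative bound.* It combines two estimates with the right powers of `d`:

* `‖a'ᵢ - aᵢ‖ ≤ C τ^p d` (`norm_tangent_sub_le`). The extrapolation error is, up to sign, the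
  `p`-th difference of `X(q_j, ·)` in time (`sum_extrapolationCoeff_sub`), whose Lipschitz constant
  in space is `O(τ^p)`. As the derivatives of the Lagrange basis sum up to zero, only differences
  between points of one element enter, and these supply the factor `d`.
* `‖α a₀ + β a₁‖ ≥ c d (|α| + |β|)` (`diam_mul_le_norm_tangent`). The Lagrange basis reproduces
  affine functions (by the Chu-Vandermonde identity), and the nodes are `O(d²)` close to the Lagrange
  points of the flat triangle; so `aᵢ` is `L (vᵢ₊₁ - v₀)` up to `O(d²)`, where `L` is a
  derivative of `X(·, t)` at the vertex `v₀`. The edges of the triangle are tangential to `Γ` up to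
  `O(d²)`, on tangential vectors `L` is bounded from below, and shape regularity bounds
  `α (v₁ - v₀) + β (v₂ - v₀)` from below.

*Geometry of the surface.* Near a point of `Γ` there is a smooth retraction `R` onto `Γ`
(`IsSmoothClosedSurface.exists_local_retraction`). Then `(x, t) ↦ X (R x) t` is a smooth function on
a ball times `[0, T]`, and calculus on this convex compact set gives all bounds that are needed on
`Γ` and `X`; they are collected in `LocalBounds`, and compactness of `Γ` makes the constants uniform
(`exists_localBounds`).
-/

namespace ESFEM

open Set Filter Topology MeasureTheory

/-! ### Local retractions onto a smooth surface -/

/-- Near each of its points, a smooth closed surface is a retract of its neighbourhood under a map of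
class `C^N`. With the defining function `f`, `l = f'(q)` and `l u = 1`, the map
`Φ x = x + (f x - l x) u` has the derivative `id` at `q` and satisfies `l (Φ x) = f x`, so that it
maps the surface into `ker l`. The retraction is `Φ⁻¹ ∘ π ∘ Φ` with the projection
`π y = y - l y u` onto `ker l`. -/
theorem IsSmoothClosedSurface.exists_local_retraction {Γ : Set E3}
    (hΓ : IsSmoothClosedSurface Γ) {q : E3} (hq : q ∈ Γ) (N : ℕ) (hN : N ≠ 0) :
    ∃ R : E3 → E3, ContDiffAt ℝ N R q ∧ (∀ᶠ x in 𝓝 q, R x ∈ Γ) ∧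
      ∀ᶠ x in 𝓝 q, x ∈ Γ → R x = x := by
  obtain ⟨U, hU, hqU, f, hf, hf', hfU⟩ := hΓ.regular q hq
  have hfq : f q = 0 := by
    have : q ∈ Γ ∩ U := ⟨hq, hqU⟩
    rw [hfU] at this
    exact this.2
  set l := fderiv ℝ f q with hl
  obtain ⟨u, hu⟩ : ∃ u, l u = 1 := by
    obtain ⟨v, hv⟩ : ∃ v, l v ≠ 0 := by
      by_contra! h
      exact hf' q hqU (ContinuousLinearMap.ext h)
    exact ⟨(l v)⁻¹ • v, by simp [hv]⟩
  have hfN : ContDiffAt ℝ N f q :=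
    ((hf q hqU).contDiffAt (hU.mem_nhds hqU)).of_le (by exact_mod_cast le_top)
  have hN' : (N : WithTop ℕ∞) ≠ 0 := by exact_mod_cast hN
  have hfd : HasFDerivAt f l q := (hfN.differentiableAt hN').hasFDerivAt
  let Φ : E3 → E3 := fun x => x + (f x - l x) • u
  let π : E3 → E3 := fun y => y - l y • u
  have hΦ : ContDiffAt ℝ N Φ q :=
    contDiffAt_id.add ((hfN.sub l.contDiff.contDiffAt).smul contDiffAt_const)
  have hΦ' : HasFDerivAt Φ ((ContinuousLinearEquiv.refl ℝ E3 : E3 ≃L[ℝ] E3) : E3 →L[ℝ] E3) q := by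
    have := (hasFDerivAt_id q).add ((hfd.sub l.hasFDerivAt).smul_const u)
    convert! this using 1
    ext x
    simp
  have hπ : ContDiff ℝ N π := contDiff_id.sub (l.contDiff.smul contDiff_const)
  set Ψ := hΦ.localInverse hΦ' hN' with hΨ
  have hΨC : ContDiffAt ℝ N Ψ (Φ q) := hΦ.to_localInverse hΦ' hN'
  have hlΦ : ∀ x, l (Φ x) = f x := fun x => by simp [Φ, hu]
  have hπq : π (Φ q) = Φ q := by simp [π, hlΦ, hfq]
  have hΨq : Ψ (Φ q) = q := hΦ.localInverse_apply_image hΦ' hN'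
  have hstrict := hΦ.hasStrictFDerivAt' hΦ' hN'
  have hleft : ∀ᶠ x in 𝓝 q, Ψ (Φ x) = x := hstrict.eventually_left_inverse
  have hright : ∀ᶠ y in 𝓝 (Φ q), Φ (Ψ y) = y := hstrict.eventually_right_inverse
  have hcont : Tendsto (fun x => π (Φ x)) (𝓝 q) (𝓝 (Φ q)) := by
    have : ContinuousAt (fun x => π (Φ x)) q :=
      hπ.continuous.continuousAt.comp hΦ.continuousAt
    simpa [ContinuousAt, hπq] using this
  have hcont' : Tendsto Ψ (𝓝 (Φ q)) (𝓝 q) := by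
    simpa [ContinuousAt, hΨq] using hΨC.continuousAt
  refine ⟨fun x => Ψ (π (Φ x)), ?_, ?_, ?_⟩
  · have hΨC' : ContDiffAt ℝ N Ψ (π (Φ q)) := by rw [hπq]; exact hΨC
    exact hΨC'.comp q (hπ.contDiffAt.comp q hΦ)
  · filter_upwards [hcont.eventually hright, (hcont'.comp hcont).eventually (hU.mem_nhds hqU)]
      with x hx hxU
    have : Ψ (π (Φ x)) ∈ {y ∈ U | f y = 0} := by
      refine ⟨hxU, ?_⟩
      rw [← hlΦ, hx]
      simp [π, hu]
    rw [← hfU] at this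
    exact this.1
  · filter_upwards [hleft, hU.mem_nhds hqU] with x hx hxU hxΓ
    have hfx : f x = 0 := by
      have : x ∈ Γ ∩ U := ⟨hxΓ, hxU⟩
      rw [hfU] at this
      exact this.2
    have : π (Φ x) = Φ x := by simp [π, hlΦ, hfx]
    simp only [this, hx]

/-! ### Differences in time and Taylor expansion on compact convex sets -/

/-- Differences of order `p` in time of a `C^p` function are `O(τ^p)`, by induction on `p`: the mean
value theorem trades one difference for one time derivative. -/
theorem exists_bound_fwdDiff {E F : Type*} [NormedAddCommGroup E] [NormedSpace ℝ E]
    [NormedAddCommGroup F] [NormedSpace ℝ F] {K : Set E} (hK : IsCompact K)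
    {T : ℝ} (hUD : UniqueDiffOn ℝ (K ×ˢ Icc 0 T)) (p : ℕ) :
    ∀ Y : E × ℝ → F, ContDiffOn ℝ p Y (K ×ˢ Icc 0 T) →
    ∃ C : ℝ, 0 ≤ C ∧ ∀ x ∈ K, ∀ τ s : ℝ, 0 ≤ τ → 0 ≤ s → s + p * τ ≤ T →
      ‖(fwdDiff τ)^[p] (fun t => Y (x, t)) s‖ ≤ C * τ ^ p := by
  induction p with
  | zero =>
    intro Y hY
    obtain ⟨C, hC⟩ := (hK.prod isCompact_Icc).exists_bound_of_continuousOn hY.continuousOn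
    refine ⟨max C 0, le_max_right _ _, fun x hx τ s hτ hs hsT => ?_⟩
    simpa using Or.inl (hC (x, s) ⟨hx, hs, by simpa using hsT⟩)
  | succ p ih =>
    intro Y hY
    let Z : E × ℝ → F := fun z => fderivWithin ℝ Y (K ×ˢ Icc 0 T) z (0, 1)
    have hZ : ContDiffOn ℝ p Z (K ×ˢ Icc 0 T) :=
      (hY.fderivWithin hUD (by norm_cast)).clm_apply contDiffOn_const
    obtain ⟨C, hC0, hC⟩ := ih Z hZ
    refine ⟨C, hC0, fun x hx τ s hτ hs hsT => ?_⟩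
    have hder : ∀ t ∈ Icc 0 T, HasDerivWithinAt (fun t => Y (x, t)) (Z (x, t)) (Icc 0 T) t := by
      intro t ht
      have h1 : HasFDerivWithinAt Y (fderivWithin ℝ Y (K ×ˢ Icc 0 T) (x, t))
          (K ×ˢ Icc 0 T) (x, t) :=
        (hY.differentiableOn (by norm_cast) (x, t) ⟨hx, ht⟩).hasFDerivWithinAt
      have h2 : HasDerivWithinAt (fun t : ℝ => (x, t)) ((0 : E), (1 : ℝ)) (Icc 0 T) t :=
        (hasDerivWithinAt_const _ _ _).prodMk (hasDerivWithinAt_id _ _)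
      exact h1.comp_hasDerivWithinAt t h2 (fun t ht => ⟨hx, ht⟩)
    push_cast at hsT
    have hder' : ∀ t ∈ Icc s (s + τ),
        HasDerivWithinAt ((fwdDiff τ)^[p] (fun t => Y (x, t)))
          ((fwdDiff τ)^[p] (fun t => Z (x, t)) t) (Icc s (s + τ)) t := by
      intro t ht
      simp only [funext (fwdDiff_iter_eq_sum_shift τ _ p)]
      have hp : ∀ k ∈ Finset.range (p + 1), HasDerivWithinAt
          (fun t => ((-1 : ℤ) ^ (p - k) * p.choose k) • Y (x, t + k • τ))
          (((-1 : ℤ) ^ (p - k) * p.choose k) • Z (x, t + k • τ)) (Icc s (s + τ)) t := by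
        intro k hk
        have hk' : (k : ℝ) ≤ p := by
          exact_mod_cast Nat.lt_succ_iff.mp (Finset.mem_range.mp hk)
        have hk0 : 0 ≤ (k : ℝ) * τ := by positivity
        have hkp : (k : ℝ) * τ ≤ p * τ := by gcongr
        have hm : MapsTo (fun t => t + k • τ) (Icc s (s + τ)) (Icc 0 T) := by
          intro r hr
          simp only [nsmul_eq_mul, mem_Icc] at hr ⊢
          constructor <;> nlinarith
        have h3 := (hder _ (hm ht)).scomp t
          ((hasDerivWithinAt_id t (Icc s (s + τ))).add_const (k • τ)) hm
        simp only [one_smul] at h3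
        have h4 := h3.const_smul (((-1 : ℤ) ^ (p - k) * p.choose k : ℤ) : ℝ)
        simpa only [Int.cast_smul_eq_zsmul, Pi.smul_def, Function.comp_def, id_eq] using h4
      exact HasDerivWithinAt.fun_sum hp
    have := Convex.norm_image_sub_le_of_norm_hasDerivWithin_le (C := C * τ ^ p) hder'
      (fun t ht => hC x hx τ t hτ (hs.trans ht.1) (by nlinarith [ht.2]))
      (convex_Icc _ _) (x := s) (y := s + τ) (by simp [hτ]) (by simp [hτ])
    rw [Function.iterate_succ_apply', fwdDiff]
    refine this.trans (le_of_eq ?_)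
    simp [abs_of_nonneg hτ]
    ring

theorem exists_taylor_bound {E F : Type*} [NormedAddCommGroup E] [NormedSpace ℝ E]
    [NormedAddCommGroup F] [NormedSpace ℝ F] {S : Set E} (hS : IsCompact S) (hconv : Convex ℝ S)
    (hUD : UniqueDiffOn ℝ S) {g : E → F} (hg : ContDiffOn ℝ 2 g S) :
    ∃ C : ℝ, 0 ≤ C ∧ ∀ z ∈ S, ∀ z' ∈ S,
      ‖g z' - g z - fderivWithin ℝ g S z (z' - z)‖ ≤ C * ‖z' - z‖ ^ 2 := by
  have hD : ContDiffOn ℝ 1 (fderivWithin ℝ g S) S := hg.fderivWithin hUD (by norm_num)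
  obtain ⟨C, hC⟩ := hS.exists_bound_of_continuousOn
    (hD.continuousOn_fderivWithin hUD le_rfl)
  refine ⟨max C 0, le_max_right _ _, fun z hz z' hz' => ?_⟩
  have hlip : ∀ y ∈ S, ‖fderivWithin ℝ g S y - fderivWithin ℝ g S z‖ ≤ max C 0 * ‖y - z‖ :=
    fun y hy => hconv.norm_image_sub_le_of_norm_fderivWithin_le
      (hD.differentiableOn one_ne_zero) (fun x hx => (hC x hx).trans (le_max_left _ _)) hz hy
  have hseg : segment ℝ z z' ⊆ S := hconv.segment_subset hz hz'
  have := (convex_segment z z').norm_image_sub_le_of_norm_hasFDerivWithin_le'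
    (f := g) (f' := fderivWithin ℝ g S) (φ := fderivWithin ℝ g S z) (C := max C 0 * ‖z' - z‖)
    (fun x hx => ((hg.differentiableOn two_ne_zero x (hseg hx)).hasFDerivWithinAt).mono hseg)
    (fun x hx => ?_) (left_mem_segment ℝ z z') (right_mem_segment ℝ z z')
  · refine this.trans (le_of_eq (by ring))
  · refine (hlip x (hseg hx)).trans ?_
    gcongr
    obtain ⟨a, b, ha, hb, hab, rfl⟩ := hx
    have : a • z + b • z' - z = b • (z' - z) := by
      rw [← eq_sub_iff_add_eq] at hab
      subst hab
      module
    rw [this, norm_smul, Real.norm_of_nonneg hb]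
    exact mul_le_of_le_one_left (norm_nonneg _) (by linarith)

/-- The Lipschitz constant in space of the difference of order `p` in time is `O(τ^p)`, as the
spatial derivative of the difference is the difference of the spatial derivative. -/
theorem exists_lipschitz_fwdDiff {E F : Type*} [NormedAddCommGroup E] [NormedSpace ℝ E]
    [NormedAddCommGroup F] [NormedSpace ℝ F] {K : Set E} (hK : IsCompact K) (hconv : Convex ℝ K)
    {T : ℝ} (hUD : UniqueDiffOn ℝ (K ×ˢ Icc 0 T)) (p : ℕ)
    {Y : E × ℝ → F} (hY : ContDiffOn ℝ (p + 1 : ℕ) Y (K ×ˢ Icc 0 T)) :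
    ∃ C : ℝ, 0 ≤ C ∧ ∀ x ∈ K, ∀ x' ∈ K, ∀ τ s : ℝ, 0 ≤ τ → 0 ≤ s → s + p * τ ≤ T →
      ‖(fwdDiff τ)^[p] (fun t => Y (x', t)) s - (fwdDiff τ)^[p] (fun t => Y (x, t)) s‖ ≤
        C * τ ^ p * ‖x' - x‖ := by
  let Z : E × ℝ → (E →L[ℝ] F) := fun z =>
    (fderivWithin ℝ Y (K ×ˢ Icc 0 T) z).comp (ContinuousLinearMap.inl ℝ E ℝ)
  have hZ : ContDiffOn ℝ p Z (K ×ˢ Icc 0 T) :=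
    (hY.fderivWithin hUD (by norm_cast)).clm_comp contDiffOn_const
  obtain ⟨C, hC0, hC⟩ := exists_bound_fwdDiff hK hUD p Z hZ
  refine ⟨C, hC0, fun x hx x' hx' τ s hτ hs hsT => ?_⟩
  have hder : ∀ t ∈ Icc 0 T, ∀ x ∈ K, HasFDerivWithinAt (fun x => Y (x, t)) (Z (x, t)) K x := by
    intro t ht x hx
    have h1 : HasFDerivWithinAt Y (fderivWithin ℝ Y (K ×ˢ Icc 0 T) (x, t))
        (K ×ˢ Icc 0 T) (x, t) :=
      (hY.differentiableOn (by norm_cast) (x, t) ⟨hx, ht⟩).hasFDerivWithinAt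
    have h2 : HasFDerivWithinAt (fun x : E => (x, t)) (ContinuousLinearMap.inl ℝ E ℝ) K x :=
      (hasFDerivAt_prodMk_left x t).hasFDerivWithinAt
    have hm : MapsTo (fun x : E => (x, t)) K (K ×ˢ Icc 0 T) := fun x hx => ⟨hx, ht⟩
    exact HasFDerivWithinAt.comp x h1 h2 hm
  have hder' : ∀ x ∈ K, HasFDerivWithinAt (fun x => (fwdDiff τ)^[p] (fun t => Y (x, t)) s)
      ((fwdDiff τ)^[p] (fun t => Z (x, t)) s) K x := by
    intro x hx
    simp only [fwdDiff_iter_eq_sum_shift]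
    refine HasFDerivWithinAt.fun_sum fun k hk => ?_
    have hk' : (k : ℝ) ≤ p := by
      exact_mod_cast Nat.lt_succ_iff.mp (Finset.mem_range.mp hk)
    have hk0 : 0 ≤ (k : ℝ) * τ := by positivity
    have hkp : (k : ℝ) * τ ≤ p * τ := by gcongr
    have ht : s + k • τ ∈ Icc 0 T := by
      simp only [nsmul_eq_mul, mem_Icc]
      constructor <;> linarith
    have h4 := (hder _ ht x hx).const_smul (((-1 : ℤ) ^ (p - k) * p.choose k : ℤ) : ℝ)
    simpa only [Int.cast_smul_eq_zsmul, Pi.smul_def] using h4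
  exact hconv.norm_image_sub_le_of_norm_hasFDerivWithin_le hder'
    (fun x hx => hC x hx τ s hτ hs hsT) hx hx'

/-! ### Uniform local bounds for the evolving surface -/

/-- The properties of `Γ` and `X` near the point `v` of `Γ` that enter the estimates on an element
with vertex `v`, for points at distance at most `ρ` from `v` and with one constant `C`. Here `P` plays
the role of the projection onto the tangent plane of `Γ` at `v`, and `L` that of a derivative of
`X(·, t)` at `v`:
* chords of `Γ` at `v` are fixed by `P` up to second order;
* `v + w` is close to `Γ` if `w` is almost fixed by `P`;
* `L` is bounded, bounded from below on the vectors fixed by `P`, and linearizes `X(·, t)`;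
* the difference of order `p` in time of `X(x, ·) - X(v, ·)` is at most `C τ^p ‖x - v‖`. -/
def LocalBounds (Γ : Set E3) (T : ℝ) (X : E3 → ℝ → E3) (p : ℕ) (ρ C : ℝ) (v : E3) : Prop :=
  ∃ P : E3 →L[ℝ] E3,
    (∀ x ∈ Γ, dist x v ≤ ρ → ‖x - v - P (x - v)‖ ≤ C * ‖x - v‖ ^ 2) ∧
    (∀ y, dist y v ≤ ρ → Metric.infDist y Γ ≤ ‖y - v - P (y - v)‖ + C * ‖y - v‖ ^ 2) ∧
    (∀ t ∈ Icc 0 T, ∃ L : E3 →L[ℝ] E3, ‖L‖ ≤ C ∧ (∀ w, ‖w‖ ≤ C * (‖L w‖ + ‖w - P w‖)) ∧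
      ∀ x ∈ Γ, dist x v ≤ ρ → ‖X x t - X v t - L (x - v)‖ ≤ C * ‖x - v‖ ^ 2) ∧
    ∀ x ∈ Γ, dist x v ≤ ρ → ∀ τ s : ℝ, 0 ≤ τ → 0 ≤ s → s + p * τ ≤ T →
      ‖(fwdDiff τ)^[p] (X x) s - (fwdDiff τ)^[p] (X v) s‖ ≤ C * τ ^ p * ‖x - v‖

theorem LocalBounds.mono {Γ : Set E3} {T : ℝ} {X : E3 → ℝ → E3} {p : ℕ} {ρ ρ' C C' : ℝ} {v : E3}
    (h : LocalBounds Γ T X p ρ C v) (hρ : ρ' ≤ ρ) (hC : C ≤ C') :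
    LocalBounds Γ T X p ρ' C' v := by
  obtain ⟨P, h1, h2, h3, h4⟩ := h
  refine ⟨P, fun x hx hd => (h1 x hx (hd.trans hρ)).trans (by gcongr),
    fun y hd => (h2 y (hd.trans hρ)).trans (by gcongr), fun t ht => ?_,
    fun x hx hd τ s hτ hs hT => (h4 x hx (hd.trans hρ) τ s hτ hs hT).trans (by gcongr)⟩
  obtain ⟨L, hL, hL', hL''⟩ := h3 t ht
  exact ⟨L, hL.trans hC, fun w => (hL' w).trans (by gcongr),
    fun x hx hd => (hL'' x hx (hd.trans hρ)).trans (by gcongr)⟩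

theorem natCast_le_infty (n : ℕ) : (n : WithTop ℕ∞) ≤ ∞ := by exact_mod_cast le_top

theorem natCast_ne_infty (n : ℕ) : (n : WithTop ℕ∞) ≠ ∞ := by
  exact_mod_cast WithTop.coe_ne_top

/-- Nondegeneracy of the evolution in terms of a local retraction `R` with derivative `P` at `v`: the
spatial derivative of `(x, t) ↦ X (R x) t` is injective on the fixed vectors of `P`, because these
are tangent vectors of `Γ` and the spatial derivative is a derivative of `X(·, t)` along `Γ`. -/
theorem eq_zero_of_retraction {Γ B : Set E3} {T : ℝ} {X : E3 → ℝ → E3}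
    (hX : IsSmoothEvolution Γ T X) {R : E3 → E3} (hRΓ : ∀ x ∈ B, R x ∈ Γ)
    (hRid : ∀ x ∈ B, x ∈ Γ → R x = x) {v : E3} (hvΓ : v ∈ Γ) (hB : B ∈ 𝓝 v)
    {P : E3 →L[ℝ] E3} (hP : HasFDerivWithinAt R P B v) {t : ℝ} (ht : t ∈ Icc 0 T)
    {D : E3 × ℝ →L[ℝ] E3}
    (hD : HasFDerivWithinAt (fun z : E3 × ℝ => X (R z.1) z.2) D (B ×ˢ Icc 0 T) (v, t))
    {w : E3} (hDw : D (w, 0) = 0) (hPw : P w = w) : w = 0 := by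
  have hvB : v ∈ B := mem_of_mem_nhds hB
  refine hX.nondegenerate t ht v hvΓ (D.comp (ContinuousLinearMap.inl ℝ E3 ℝ)) ?_ w ?_
    (by simpa using hDw)
  · have h2 : HasFDerivWithinAt (fun x : E3 => (x, t)) (ContinuousLinearMap.inl ℝ E3 ℝ)
        (Γ ∩ B) v := (hasFDerivAt_prodMk_left v t).hasFDerivWithinAt
    have hm : MapsTo (fun x : E3 => (x, t)) (Γ ∩ B) (B ×ˢ Icc 0 T) := fun x hx => ⟨hx.2, ht⟩
    have h3 := HasFDerivWithinAt.comp v hD h2 hm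
    have h4 : HasFDerivWithinAt (fun x => X x t) (D.comp (ContinuousLinearMap.inl ℝ E3 ℝ))
        (Γ ∩ B) v := by
      refine h3.congr (fun x hx => ?_) ?_
      · simp [hRid x hx.2 hx.1]
      · simp [hRid v hvB hvΓ]
    exact h4.mono_of_mem_nhdsWithin (inter_mem_nhdsWithin Γ hB)
  · have hw : w ∈ tangentConeAt ℝ B v := by
      rw [tangentConeAt_of_mem_nhds hB]; trivial
    have h2 := hP.mapsTo_tangent_cone hw
    rw [hPw, hRid v hvB hvΓ] at h2
    refine tangentConeAt_mono ?_ h2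
    rintro _ ⟨x, hx, rfl⟩
    exact hRΓ x hx

/-- If, for every parameter `z` in a compact set, `L z` is injective on the fixed vectors of `P z`, then
`w` is bounded uniformly by `L z w` and the defect `w - P z w`. -/
theorem exists_norm_le_of_injective {Z E F : Type*} [TopologicalSpace Z] [NormedAddCommGroup E]
    [NormedSpace ℝ E] [FiniteDimensional ℝ E] [NormedAddCommGroup F] [NormedSpace ℝ F]
    {Q : Set Z} (hQ : IsCompact Q) {L : Z → E →L[ℝ] F} {P : Z → E →L[ℝ] E}
    (hL : ContinuousOn L Q) (hP : ContinuousOn P Q)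
    (hinj : ∀ z ∈ Q, ∀ w, L z w = 0 → P z w = w → w = 0) :
    ∃ C : ℝ, ∀ z ∈ Q, ∀ w, ‖w‖ ≤ C * (‖L z w‖ + ‖w - P z w‖) := by
  let G : Z × E → ℝ := fun z => ‖L z.1 z.2‖ + ‖z.2 - P z.1 z.2‖
  have hm : MapsTo Prod.fst (Q ×ˢ Metric.sphere (0 : E) 1) Q := fun z hz => hz.1
  have hG : ContinuousOn G (Q ×ˢ Metric.sphere 0 1) :=
    ((hL.comp continuousOn_fst hm).clm_apply continuousOn_snd).norm.add
      (continuousOn_snd.sub ((hP.comp continuousOn_fst hm).clm_apply continuousOn_snd)).norm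
  have hGpos : ∀ z ∈ Q ×ˢ Metric.sphere (0 : E) 1, 0 < G z := by
    rintro ⟨z, w⟩ ⟨hz, hw⟩
    refine lt_of_le_of_ne (by positivity) fun h0 => ?_
    simp only [G] at h0
    have h1 := norm_nonneg (L z w)
    have h2 := norm_nonneg (w - P z w)
    have := hinj z hz w (norm_eq_zero.mp (by linarith))
      (sub_eq_zero.mp (norm_eq_zero.mp (by linarith))).symm
    simp [this] at hw
  obtain ⟨m, hm, hmin⟩ := (hQ.prod (isCompact_sphere (0 : E) 1)).exists_forall_le' hG hGpos
  refine ⟨m⁻¹, fun z hz w => ?_⟩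
  rcases eq_or_ne w 0 with rfl | hw
  · simp
  have hw' : 0 < ‖w‖ := norm_pos_iff.mpr hw
  have := hmin (z, ‖w‖⁻¹ • w) ⟨hz, by simp [norm_smul, hw'.ne']⟩
  simp only [G] at this
  rw [map_smul, map_smul, ← smul_sub, norm_smul, norm_smul, norm_inv, norm_norm,
    ← mul_add, ← div_eq_inv_mul, le_div_iff₀ hw'] at this
  rwa [← div_eq_inv_mul, le_div_iff₀ hm, mul_comm]

theorem exists_localBounds_nhds {Γ : Set E3} (hΓ : IsSmoothClosedSurface Γ) {T : ℝ} (hT : 0 < T)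
    {X : E3 → ℝ → E3} (hX : IsSmoothEvolution Γ T X) (p : ℕ) {q : E3} (hq : q ∈ Γ) :
    ∃ ρ > 0, ∃ C : ℝ, ∀ v ∈ Γ, dist v q < ρ → LocalBounds Γ T X p ρ C v := by
  obtain ⟨R, hR, hRΓ, hRid⟩ := hΓ.exists_local_retraction hq (p + 2) (by omega)
  obtain ⟨U, hU, hRU⟩ := hR.contDiffOn le_rfl (fun h => absurd h (natCast_ne_infty _))
  obtain ⟨r, hr, hball⟩ := Metric.nhds_basis_closedBall.mem_iff.mp
    (Filter.inter_mem hU (Filter.inter_mem hRΓ hRid))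
  obtain ⟨B, hB⟩ : ∃ B, B = Metric.closedBall q r := ⟨_, rfl⟩
  rw [← hB] at hball
  replace hRU : ContDiffOn ℝ (p + 2 : ℕ) R B := hRU.mono fun x hx => (hball hx).1
  replace hRΓ : ∀ x ∈ B, R x ∈ Γ := fun x hx => (hball hx).2.1
  replace hRid : ∀ x ∈ B, x ∈ Γ → R x = x := fun x hx => (hball hx).2.2
  have hBc : IsCompact B := hB ▸ isCompact_closedBall q r
  have hBconv : Convex ℝ B := hB ▸ convex_closedBall q r
  have hBUD : UniqueDiffOn ℝ B := uniqueDiffOn_convex hBconv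
    ⟨q, by rw [hB, interior_closedBall _ hr.ne']; exact Metric.mem_ball_self hr⟩
  have hSc : IsCompact (B ×ˢ Icc 0 T) := hBc.prod isCompact_Icc
  have hSconv : Convex ℝ (B ×ˢ Icc 0 T) := hBconv.prod (convex_Icc 0 T)
  have hSUD : UniqueDiffOn ℝ (B ×ˢ Icc 0 T) := hBUD.prod (uniqueDiffOn_Icc hT)
  obtain ⟨Y, hYdef⟩ : ∃ Y : E3 × ℝ → E3, Y = fun z => X (R z.1) z.2 := ⟨_, rfl⟩
  have hY : ContDiffOn ℝ (p + 2 : ℕ) Y (B ×ˢ Icc 0 T) := by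
    have hmap : ContDiffOn ℝ (p + 2 : ℕ) (fun z : E3 × ℝ => (R z.1, z.2)) (B ×ˢ Icc 0 T) :=
      (hRU.comp contDiffOn_fst fun z hz => hz.1).prodMk contDiffOn_snd
    rw [hYdef]
    exact (hX.smooth.of_le (natCast_le_infty (p + 2))).comp hmap
      (fun z hz => ⟨hRΓ _ hz.1, hz.2⟩)
  have hYX : ∀ x ∈ B, x ∈ Γ → ∀ t, Y (x, t) = X x t := fun x hx hxΓ t => by
    simp only [hYdef, hRid x hx hxΓ]
  have h2p : (2 : WithTop ℕ∞) ≤ (p + 2 : ℕ) := by exact_mod_cast Nat.le_add_left 2 p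
  have h1p : (1 : WithTop ℕ∞) ≤ (p + 2 : ℕ) := by exact_mod_cast Nat.le_add_left 1 (p + 1)
  have hp2 : ((p + 2 : ℕ) : WithTop ℕ∞) ≠ 0 := by exact_mod_cast Nat.succ_ne_zero (p + 1)
  obtain ⟨C₁, hC₁0, hC₁⟩ := exists_taylor_bound hBc hBconv hBUD (hRU.of_le h2p)
  obtain ⟨C₂, hC₂0, hC₂⟩ := exists_taylor_bound hSc hSconv hSUD (hY.of_le h2p)
  obtain ⟨C₃, hC₃0, hC₃⟩ := exists_lipschitz_fwdDiff hBc hBconv hSUD p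
    (hY.of_le (by exact_mod_cast Nat.le_succ (p + 1)))
  have hDRc := hRU.continuousOn_fderivWithin hBUD h1p
  have hDYc := hY.continuousOn_fderivWithin hSUD h1p
  obtain ⟨DR, hDR⟩ : ∃ DR, DR = fderivWithin ℝ R B := ⟨_, rfl⟩
  obtain ⟨DY, hDY⟩ : ∃ DY, DY = fderivWithin ℝ Y (B ×ˢ Icc 0 T) := ⟨_, rfl⟩
  rw [← hDR] at hC₁ hDRc
  rw [← hDY] at hC₂ hDYc
  obtain ⟨L, hLdef⟩ : ∃ L : E3 × ℝ → (E3 →L[ℝ] E3),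
    L = fun z => (DY z).comp (ContinuousLinearMap.inl ℝ E3 ℝ) := ⟨_, rfl⟩
  have hLapp : ∀ z w, L z w = DY z (w, 0) := fun z w => by simp [hLdef]
  have hLc : ContinuousOn L (B ×ˢ Icc 0 T) := by
    rw [hLdef]; exact hDYc.clm_comp continuousOn_const
  obtain ⟨C₄, hC₄⟩ := hSc.exists_bound_of_continuousOn hLc
  have hB'B : Metric.closedBall q (r / 2) ⊆ B := hB ▸
    Metric.closedBall_subset_closedBall (by linarith)
  have hB'nhds : ∀ v ∈ Metric.closedBall q (r / 2), B ∈ 𝓝 v := fun v hv =>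
    hB ▸ Metric.closedBall_mem_nhds_of_mem (by
      rw [Metric.mem_closedBall] at hv
      rw [Metric.mem_ball]; linarith)
  have hQc : IsCompact ((Metric.closedBall q (r / 2) ∩ Γ) ×ˢ Icc 0 T) :=
    ((isCompact_closedBall q (r / 2)).inter_right hΓ.isCompact.isClosed).prod isCompact_Icc
  obtain ⟨C₅, hC₅⟩ := exists_norm_le_of_injective hQc (L := L) (P := fun z => DR z.1)
    (hLc.mono (prod_mono (inter_subset_left.trans hB'B) le_rfl))
    (hDRc.comp continuousOn_fst fun z hz => hB'B hz.1.1)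
    (fun z hz w hLw hPw => by
      obtain ⟨v, t⟩ := z
      have hvB := hB'B hz.1.1
      refine eq_zero_of_retraction hX hRΓ hRid hz.1.2 (hB'nhds v hz.1.1)
        (P := DR v) ?_ hz.2 (D := DY (v, t)) ?_ ?_ hPw
      · rw [hDR]
        exact (hRU.differentiableOn hp2 v hvB).hasFDerivWithinAt
      · rw [← hYdef, hDY]
        exact (hY.differentiableOn hp2 (v, t) ⟨hvB, hz.2⟩).hasFDerivWithinAt
      · rw [← hLapp, hLw])
  obtain ⟨C, hC₁C, hC₂C, hC₃C, hC₄C, hC₅C⟩ :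
      ∃ C, C₁ ≤ C ∧ C₂ ≤ C ∧ C₃ ≤ C ∧ C₄ ≤ C ∧ C₅ ≤ C :=
    ⟨max (max C₁ C₂) (max (max C₃ C₄) C₅), by simp, by simp, by simp, by simp, by simp⟩
  refine ⟨r / 2, by positivity, C, fun v hvΓ hv => ?_⟩
  have hvB : v ∈ B := hB'B hv.le
  have hnear : ∀ x, dist x v ≤ r / 2 → x ∈ B := fun x hx => by
    rw [hB, Metric.mem_closedBall]
    linarith [dist_triangle x v q]
  refine ⟨DR v, fun x hx hd => ?_, fun y hd => ?_, fun t ht => ?_, ?_⟩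
  · have := hC₁ v hvB x (hnear x hd)
    rw [hRid x (hnear x hd) hx, hRid v hvB hvΓ] at this
    exact this.trans (by gcongr)
  · have h1 := hC₁ v hvB y (hnear y hd)
    rw [hRid v hvB hvΓ] at h1
    refine (Metric.infDist_le_dist_of_mem (hRΓ y (hnear y hd))).trans ?_
    rw [dist_eq_norm]
    have h2 : y - R y = (y - v - DR v (y - v)) - (R y - v - DR v (y - v)) := by abel
    rw [h2]
    refine (norm_sub_le _ _).trans ?_
    gcongr
    exact h1.trans (by gcongr)
  · have hvt : (v, t) ∈ B ×ˢ Icc 0 T := mk_mem_prod hvB ht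
    refine ⟨L (v, t), (hC₄ _ hvt).trans hC₄C,
      fun w => (hC₅ (v, t) (mk_mem_prod ⟨hv.le, hvΓ⟩ ht) w).trans (by gcongr), fun x hx hd => ?_⟩
    have hxt : (x, t) ∈ B ×ˢ Icc 0 T := mk_mem_prod (hnear x hd) ht
    have := hC₂ (v, t) hvt (x, t) hxt
    rw [hYX x (hnear x hd) hx, hYX v hvB hvΓ] at this
    have h0 : ((x, t) : E3 × ℝ) - (v, t) = (x - v, 0) := by
      rw [Prod.mk_sub_mk, sub_self]
    have h1 : ‖((x - v, 0) : E3 × ℝ)‖ = ‖x - v‖ := by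
      rw [Prod.norm_def, norm_zero, max_eq_left (norm_nonneg _)]
    rw [h0, h1, ← hLapp] at this
    exact this.trans (mul_le_mul_of_nonneg_right hC₂C (by positivity))
  · intro x hx hd τ s hτ hs hsT
    have := hC₃ v hvB x (hnear x hd) τ s hτ hs hsT
    rw [funext (hYX x (hnear x hd) hx), funext (hYX v hvB hvΓ)] at this
    exact this.trans (by gcongr)

theorem exists_localBounds {Γ : Set E3} (hΓ : IsSmoothClosedSurface Γ) {T : ℝ} (hT : 0 < T)
    {X : E3 → ℝ → E3} (hX : IsSmoothEvolution Γ T X) (p : ℕ) :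
    ∃ ρ > 0, ∃ C : ℝ, 1 ≤ C ∧ ∀ v ∈ Γ, LocalBounds Γ T X p ρ C v := by
  refine hΓ.isCompact.induction_on
    (p := fun s => ∃ ρ > 0, ∃ C : ℝ, 1 ≤ C ∧ ∀ v ∈ s, LocalBounds Γ T X p ρ C v) ?_ ?_ ?_ ?_
  · exact ⟨1, one_pos, 1, le_rfl, by simp⟩
  · rintro s t hst ⟨ρ, hρ, C, hC, h⟩
    exact ⟨ρ, hρ, C, hC, fun v hv => h v (hst hv)⟩
  · rintro s t ⟨ρ, hρ, C, hC, h⟩ ⟨ρ', hρ', C', hC', h'⟩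
    refine ⟨min ρ ρ', lt_min hρ hρ', max C C', hC.trans (le_max_left _ _), ?_⟩
    rintro v (hv | hv)
    · exact (h v hv).mono (min_le_left _ _) (le_max_left _ _)
    · exact (h' v hv).mono (min_le_right _ _) (le_max_right _ _)
  · intro q hq
    obtain ⟨ρ, hρ, C, h⟩ := exists_localBounds_nhds hΓ hT hX p hq
    refine ⟨Γ ∩ Metric.ball q ρ, inter_mem_nhdsWithin Γ (Metric.ball_mem_nhds q hρ),
      ρ, hρ, max C 1, le_max_right _ _, fun v hv => ?_⟩
    exact (h v hv.1 hv.2).mono le_rfl (le_max_left _ _)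

/-! ### Lagrange basis polynomials -/

/-- The factors of a Lagrange basis polynomial are generalized binomial coefficients. -/
theorem prod_range_sub_div_eq_choose (x : ℝ) (n : ℕ) :
    ∏ m ∈ Finset.range n, (x - m) / ((n : ℝ) - m) = Ring.choose x n := by
  have h : ∏ m ∈ Finset.range n, ((n : ℝ) - m) = n.factorial := by
    rw [← Finset.prod_range_reflect, ← Finset.prod_range_add_one_eq_factorial, Nat.cast_prod]
    refine Finset.prod_congr rfl fun j hj => ?_
    have : j + 1 ≤ n := Finset.mem_range.mp hj
    rw [show n - 1 - j = n - (j + 1) by omega, Nat.cast_sub this]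
    push_cast
    ring
  rw [Finset.prod_div_distrib, h, Ring.choose_eq_smul, ← Polynomial.aeval_eq_smeval,
    ← Polynomial.eval_map_algebraMap, descPochhammer_map, descPochhammer_eval_eq_prod_range,
    smul_eq_mul, inv_mul_eq_div]

theorem lagrangeBasis_eq_prod_choose (k : ℕ) (a : LagrangeIndex k) (ξ : E2) :
    lagrangeBasis k a ξ = ∏ i, Ring.choose ((k : ℝ) * bary ξ i) (a.1 i : ℕ) := by
  simp only [lagrangeBasis, prod_range_sub_div_eq_choose]

theorem sum_lagrangeIndex {k : ℕ} (g : ℕ → ℕ → ℕ → ℝ) :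
    ∑ a : LagrangeIndex k, g (a.1 0) (a.1 1) (a.1 2) =
      ∑ ij ∈ Finset.HasAntidiagonal.antidiagonal k, ∑ lm ∈ Finset.HasAntidiagonal.antidiagonal ij.2, g ij.1 lm.1 lm.2 := by
  rw [Finset.sum_sigma']
  refine Finset.sum_bij
    (fun a _ => ⟨((a.1 0 : ℕ), (a.1 1 : ℕ) + (a.1 2 : ℕ)), ((a.1 1 : ℕ), (a.1 2 : ℕ))⟩)
    ?_ ?_ ?_ ?_
  · rintro ⟨a, ha⟩ -
    rw [Fin.sum_univ_three] at ha
    simp only [Finset.mem_sigma, Finset.HasAntidiagonal.mem_antidiagonal, and_true]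
    omega
  · rintro ⟨a, ha⟩ - ⟨b, hb⟩ - hab
    simp only [Sigma.mk.injEq, Prod.mk.injEq, heq_eq_eq] at hab
    apply Subtype.ext
    funext i
    apply Fin.ext
    fin_cases i
    · exact hab.1.1
    · exact hab.2.1
    · exact hab.2.2
  · rintro ⟨⟨i, j⟩, ⟨l, m⟩⟩ h
    simp only [Finset.mem_sigma, Finset.HasAntidiagonal.mem_antidiagonal] at h
    obtain ⟨h1, h2⟩ := h
    refine ⟨⟨![⟨i, by omega⟩, ⟨l, by omega⟩, ⟨m, by omega⟩], ?_⟩, Finset.mem_univ _, ?_⟩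
    · rw [Fin.sum_univ_three]
      simp
      omega
    · simp [h2]
  · intro a _
    rfl

/-- The Chu-Vandermonde identity for three summands. -/
theorem sum_prod_choose (k : ℕ) (x : Fin 3 → ℝ) :
    ∑ a : LagrangeIndex k, ∏ i, Ring.choose (x i) (a.1 i : ℕ) = Ring.choose (∑ i, x i) k := by
  simp only [Fin.prod_univ_three, Fin.sum_univ_three]
  rw [sum_lagrangeIndex
    (fun i j l => Ring.choose (x 0) i * Ring.choose (x 1) j * Ring.choose (x 2) l), add_assoc,
    Ring.add_choose_eq k (Commute.all _ _)]
  refine Finset.sum_congr rfl fun ij _ => ?_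
  rw [Ring.add_choose_eq _ (Commute.all _ _), Finset.mul_sum]
  simp only [mul_assoc]

/-- Moments of the three-term Chu-Vandermonde identity; `i · choose x i = x · choose (x - 1) (i - 1)`
reduces them to the identity of degree `k - 1`. -/
theorem sum_mul_prod_choose_zero (k : ℕ) (hk : 1 ≤ k) (x : Fin 3 → ℝ) :
    ∑ a : LagrangeIndex k, ((a.1 0 : ℕ) : ℝ) * ∏ i, Ring.choose (x i) (a.1 i : ℕ) =
      x 0 * Ring.choose (∑ i, x i - 1) (k - 1) := by
  simp only [Fin.prod_univ_three, Fin.sum_univ_three]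
  rw [sum_lagrangeIndex (fun i j l =>
    (i : ℝ) * (Ring.choose (x 0) i * Ring.choose (x 1) j * Ring.choose (x 2) l))]
  obtain ⟨n, rfl⟩ : ∃ n, k = n + 1 := ⟨k - 1, by omega⟩
  have h : ∀ i : ℕ, ((i + 1 : ℕ) : ℝ) * Ring.choose (x 0) (i + 1) =
      x 0 * Ring.choose (x 0 - 1) i := fun i => by
    have := Ring.choose_smul_choose (x 0) (n := i + 1) (k := 1) (by omega)
    simpa using this
  rw [Finset.Nat.sum_antidiagonal_succ]
  simp only [Nat.cast_zero, zero_mul, Finset.sum_const_zero, zero_add, Nat.add_sub_cancel]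
  rw [show x 0 + x 1 + x 2 - 1 = (x 0 - 1) + (x 1 + x 2) by ring,
    Ring.add_choose_eq n (Commute.all _ _), Finset.mul_sum]
  refine Finset.sum_congr rfl fun ij _ => ?_
  rw [Ring.add_choose_eq _ (Commute.all _ _), Finset.mul_sum, Finset.mul_sum]
  refine Finset.sum_congr rfl fun lm _ => ?_
  linear_combination Ring.choose (x 1) lm.1 * Ring.choose (x 2) lm.2 * h ij.1

theorem sum_mul_prod_choose (k : ℕ) (hk : 1 ≤ k) (x : Fin 3 → ℝ) (m : Fin 3) :
    ∑ a : LagrangeIndex k, ((a.1 m : ℕ) : ℝ) * ∏ i, Ring.choose (x i) (a.1 i : ℕ) =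
      x m * Ring.choose (∑ i, x i - 1) (k - 1) := by
  let s : Equiv.Perm (Fin 3) := Equiv.swap 0 m
  let e : LagrangeIndex k ≃ LagrangeIndex k :=
    { toFun := fun a => ⟨fun i => a.1 (s i), by
        rw [Equiv.sum_comp s (fun i => (a.1 i : ℕ))]; exact a.2⟩
      invFun := fun a => ⟨fun i => a.1 (s i), by
        rw [Equiv.sum_comp s (fun i => (a.1 i : ℕ))]; exact a.2⟩
      left_inv := fun a => by ext i; simp [s]
      right_inv := fun a => by ext i; simp [s] }
  have h := sum_mul_prod_choose_zero k hk (fun i => x (s i))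
  rw [← Equiv.sum_comp e, Equiv.sum_comp s x] at h
  have hs0 : s 0 = m := Equiv.swap_apply_left 0 m
  rw [hs0] at h
  rw [← h]
  refine Finset.sum_congr rfl fun a _ => ?_
  have h1 : ∏ i, Ring.choose (x (s i)) ((e a).1 i : ℕ) = ∏ i, Ring.choose (x i) (a.1 i : ℕ) :=
    Equiv.prod_comp s (fun i => Ring.choose (x i) (a.1 i : ℕ))
  rw [h1]
  simp [e, hs0]

theorem sum_bary (ξ : E2) : ∑ i, bary ξ i = 1 := by
  simp [Fin.sum_univ_three, bary]
  ring

theorem sum_lagrangeBasis (k : ℕ) (ξ : E2) : ∑ a, lagrangeBasis k a ξ = 1 := by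
  simp only [lagrangeBasis_eq_prod_choose, sum_prod_choose, ← Finset.mul_sum, sum_bary, mul_one]
  rw [Ring.choose_natCast]
  simp

/-- The Lagrange basis reproduces the barycentric coordinates, hence all affine functions. -/
theorem sum_mul_lagrangeBasis (k : ℕ) (hk : 1 ≤ k) (ξ : E2) (m : Fin 3) :
    ∑ a : LagrangeIndex k, (((a.1 m : ℕ) : ℝ) / k) * lagrangeBasis k a ξ = bary ξ m := by
  have hk' : (k : ℝ) ≠ 0 := by positivity
  simp only [lagrangeBasis_eq_prod_choose, div_mul_eq_mul_div, ← Finset.sum_div]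
  rw [sum_mul_prod_choose k hk, ← Finset.mul_sum, sum_bary, mul_one,
    show (k : ℝ) - 1 = ((k - 1 : ℕ) : ℝ) by rw [Nat.cast_sub hk]; simp, Ring.choose_natCast]
  simp
  field_simp

theorem contDiff_bary (i : Fin 3) : ContDiff ℝ ∞ fun ξ => bary ξ i := by
  fin_cases i <;> simp [bary] <;> fun_prop

theorem contDiff_lagrangeBasis (k : ℕ) (a : LagrangeIndex k) : ContDiff ℝ ∞ (lagrangeBasis k a) := by
  unfold lagrangeBasis
  refine contDiff_prod fun i _ => contDiff_prod fun m _ => ?_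
  exact ((contDiff_const.mul (contDiff_bary i)).sub contDiff_const).div_const _

theorem fderiv_bary_apply (ξ : E2) (m : Fin 3) (i : Fin 2) :
    fderiv ℝ (fun ξ => bary ξ m) ξ (EuclideanSpace.single i 1) =
      (if m = i.succ then 1 else 0) - if m = 0 then 1 else 0 := by
  have h0 : HasFDerivAt (fun ξ : E2 => ξ 0) (EuclideanSpace.proj 0 : E2 →L[ℝ] ℝ) ξ :=
    (EuclideanSpace.proj 0 : E2 →L[ℝ] ℝ).hasFDerivAt
  have h1 : HasFDerivAt (fun ξ : E2 => ξ 1) (EuclideanSpace.proj 1 : E2 →L[ℝ] ℝ) ξ :=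
    (EuclideanSpace.proj 1 : E2 →L[ℝ] ℝ).hasFDerivAt
  fin_cases m
  · have : HasFDerivAt (fun ξ => bary ξ 0) _ ξ := ((hasFDerivAt_const (1 : ℝ) ξ).sub h0).sub h1
    simp only [Fin.zero_eta]
    rw [this.fderiv]
    fin_cases i <;> simp
  · simp only [Fin.mk_one]
    rw [show (fun ξ => bary ξ 1) = fun ξ : E2 => ξ 0 from rfl, h0.fderiv]
    fin_cases i <;> simp
  · rw [show (fun ξ => bary ξ ((fun i => i) ⟨2, by decide⟩)) = fun ξ : E2 => ξ 1 from rfl, h1.fderiv]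
    fin_cases i <;> simp

/-- The partial derivative with respect to `ξ_i` of the Lagrange basis polynomial with index `a`. -/
noncomputable def lagrangeDeriv (k : ℕ) (a : LagrangeIndex k) (ξ : E2) (i : Fin 2) : ℝ :=
  fderiv ℝ (lagrangeBasis k a) ξ (EuclideanSpace.single i 1)

theorem differentiable_lagrangeBasis (k : ℕ) (a : LagrangeIndex k) :
    Differentiable ℝ (lagrangeBasis k a) :=
  (contDiff_lagrangeBasis k a).differentiable (by simp)

theorem continuous_lagrangeDeriv (k : ℕ) (a : LagrangeIndex k) (i : Fin 2) :
    Continuous fun ξ => lagrangeDeriv k a ξ i :=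
  ((contDiff_lagrangeBasis k a).continuous_fderiv (by simp)).clm_apply continuous_const

theorem sum_mul_lagrangeDeriv (k : ℕ) (c : LagrangeIndex k → ℝ) (ξ : E2) (i : Fin 2) :
    ∑ a, c a * lagrangeDeriv k a ξ i =
      fderiv ℝ (fun ξ => ∑ a, c a * lagrangeBasis k a ξ) ξ (EuclideanSpace.single i 1) := by
  rw [fderiv_fun_sum fun a _ => ((differentiable_lagrangeBasis k a) ξ).const_mul (c a)]
  rw [sum_apply]
  refine Finset.sum_congr rfl fun a _ => ?_
  rw [fderiv_const_mul ((differentiable_lagrangeBasis k a) ξ)]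
  rfl

theorem sum_lagrangeDeriv (k : ℕ) (ξ : E2) (i : Fin 2) :
    ∑ a, lagrangeDeriv k a ξ i = 0 := by
  have := sum_mul_lagrangeDeriv k (fun _ => 1) ξ i
  simp only [one_mul, sum_lagrangeBasis] at this
  simpa using this

theorem sum_mul_lagrangeDeriv_bary (k : ℕ) (hk : 1 ≤ k) (ξ : E2) (m : Fin 3) (i : Fin 2) :
    ∑ a : LagrangeIndex k, (((a.1 m : ℕ) : ℝ) / k) * lagrangeDeriv k a ξ i =
      (if m = i.succ then 1 else 0) - if m = 0 then 1 else 0 := by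
  rw [sum_mul_lagrangeDeriv]
  simp only [sum_mul_lagrangeBasis k hk]
  exact fderiv_bary_apply ξ m i

theorem sum_lagrangeDeriv_smul_affine {V : Type*} [AddCommGroup V] [Module ℝ V]
    (k : ℕ) (hk : 1 ≤ k) (ξ : E2) (i : Fin 2) (v : Fin 3 → V) :
    ∑ a : LagrangeIndex k, lagrangeDeriv k a ξ i • ∑ m, (((a.1 m : ℕ) : ℝ) / (k : ℝ)) • v m =
      v i.succ - v 0 := by
  simp only [Finset.smul_sum, smul_smul]
  rw [Finset.sum_comm]
  have h : ∀ m, ∑ a : LagrangeIndex k, (lagrangeDeriv k a ξ i * (((a.1 m : ℕ) : ℝ) / (k : ℝ))) • v m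
      = ((if m = i.succ then 1 else 0) - if m = 0 then 1 else 0 : ℝ) • v m := fun m => by
    rw [← Finset.sum_smul, ← sum_mul_lagrangeDeriv_bary k hk ξ m i]
    simp only [mul_comm]
  simp only [h, sub_smul, Finset.sum_sub_distrib, ite_smul, one_smul, zero_smul,
    Finset.sum_ite_eq', Finset.mem_univ, if_true]

theorem isCompact_refTriangle : IsCompact refTriangle := by
  refine Metric.isCompact_of_isClosed_isBounded ?_ ?_
  · have h0 : Continuous fun ξ : E2 => ξ 0 := by fun_prop
    have h1 : Continuous fun ξ : E2 => ξ 1 := by fun_prop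
    exact (isClosed_le continuous_const h0).inter
      ((isClosed_le continuous_const h1).inter (isClosed_le (h0.add h1) continuous_const))
  · refine (Metric.isBounded_closedBall (x := (0 : E2)) (r := 1)).subset fun ξ hξ => ?_
    obtain ⟨h0, h1, h2⟩ := hξ
    rw [mem_closedBall_zero_iff, EuclideanSpace.norm_eq, Real.sqrt_le_left zero_le_one,
      Fin.sum_univ_two, Real.norm_eq_abs, Real.norm_eq_abs, sq_abs, sq_abs]
    nlinarith

theorem exists_bound_lagrangeDeriv (k : ℕ) :
    ∃ C : ℝ, 0 ≤ C ∧ ∀ ξ ∈ refTriangle, ∀ i, ∑ a, |lagrangeDeriv k a ξ i| ≤ C := by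
  have hc : ∀ i, ContinuousOn (fun ξ => ∑ a, |lagrangeDeriv k a ξ i|) refTriangle := fun i =>
    (continuous_finsetSum _ fun a _ => (continuous_lagrangeDeriv k a i).abs).continuousOn
  choose C hC using fun i => isCompact_refTriangle.exists_bound_of_continuousOn (hc i)
  refine ⟨max 0 (max (C 0) (C 1)), le_max_left _ _, fun ξ hξ i => ?_⟩
  refine (le_abs_self _).trans ((hC i ξ hξ).trans ?_)
  fin_cases i <;> simp

theorem norm_sum_lagrangeDeriv_smul_le {k : ℕ} {C δ : ℝ} {ξ : E2} {i : Fin 2}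
    (hC : ∑ a, |lagrangeDeriv k a ξ i| ≤ C) (hδ : 0 ≤ δ) {y : LagrangeIndex k → E3}
    (hy : ∀ a, ‖y a‖ ≤ δ) :
    ‖∑ a, lagrangeDeriv k a ξ i • y a‖ ≤ C * δ := by
  calc ‖∑ a, lagrangeDeriv k a ξ i • y a‖ ≤ ∑ a, |lagrangeDeriv k a ξ i| * δ := by
        refine norm_sum_le_of_le _ fun a _ => ?_
        rw [norm_smul, Real.norm_eq_abs]
        exact mul_le_mul_of_nonneg_left (hy a) (abs_nonneg _)
    _ ≤ C * δ := by
        rw [← Finset.sum_mul]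
        gcongr

/-! ### Area element and gradients under relative perturbations -/

theorem norm_le_two_mul_of_sub_le {E : Type*} [NormedAddCommGroup E] {x y : E} {ε : ℝ} (hε : ε ≤ 1 / 2)
    (h : ‖y - x‖ ≤ ε * ‖x‖) : ‖x‖ ≤ (1 + 2 * ε) * ‖y‖ := by
  have h3 := norm_sub_norm_le x y
  rw [norm_sub_rev] at h3
  have hx := norm_nonneg x
  have hε0 : 0 ≤ ε ∨ ‖x‖ = 0 := by
    by_contra! hc
    have : 0 < ‖x‖ := lt_of_le_of_ne hx (Ne.symm hc.2)
    nlinarith [norm_nonneg (y - x)]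
  rcases hε0 with h0 | h0
  · have h4 : (1 - ε) * ‖x‖ ≤ ‖y‖ := by linarith
    have h5 : (1 + 2 * ε) * ((1 - ε) * ‖x‖) ≤ (1 + 2 * ε) * ‖y‖ := by gcongr
    nlinarith [mul_nonneg (mul_nonneg h0 (by linarith : (0 : ℝ) ≤ 1 - 2 * ε)) hx]
  · rw [h0] at h ⊢
    have : ‖y - x‖ = 0 := le_antisymm (by simpa using h) (norm_nonneg _)
    rw [sub_eq_zero.mp (norm_eq_zero.mp this), h0]
    simp

section Area

variable {E : Type*} [NormedAddCommGroup E] [InnerProductSpace ℝ E]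

/-- The Gram determinant of `a` and `b`, the squared area of the parallelogram they span. -/
noncomputable def areaSq (a b : E) : ℝ := ‖a‖ ^ 2 * ‖b‖ ^ 2 - ⟪a, b⟫_ℝ ^ 2

/-- The area of the parallelogram spanned by `a` and `b`. -/
noncomputable def area (a b : E) : ℝ := Real.sqrt (areaSq a b)

theorem areaSq_nonneg (a b : E) : 0 ≤ areaSq a b := by
  have h := abs_real_inner_le_norm a b
  have := sq_le_sq' (by linarith [neg_abs_le ⟪a, b⟫_ℝ, abs_le.mp h]) (abs_le.mp h).2
  rw [areaSq]
  nlinarith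

theorem area_nonneg (a b : E) : 0 ≤ area a b := Real.sqrt_nonneg _

/-- Side times height with any oblique height; there is equality for the orthogonal one. -/
theorem areaSq_le_mul (a b : E) (s : ℝ) : areaSq a b ≤ ‖a‖ ^ 2 * ‖b - s • a‖ ^ 2 := by
  rw [areaSq, norm_sub_sq_real, norm_smul, inner_smul_right, real_inner_comm a b,
    Real.norm_eq_abs, mul_pow, sq_abs]
  nlinarith [sq_nonneg (s * ‖a‖ ^ 2 - ⟪a, b⟫_ℝ)]

theorem area_le_of_norm_le {a b a' b' : E} {κ : ℝ}
    (h : ∀ α β : ℝ, ‖α • a' + β • b'‖ ≤ κ * ‖α • a + β • b‖) :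
    area a' b' ≤ κ ^ 2 * area a b := by
  rw [area, area, Real.sqrt_le_left (by positivity), mul_pow, Real.sq_sqrt (areaSq_nonneg a b)]
  rcases eq_or_ne a 0 with rfl | ha
  · have h1 : a' = 0 := by simpa using h 1 0
    simp [areaSq, h1]
  have ha' : 0 < ‖a‖ := norm_pos_iff.mpr ha
  have h1 : ‖a'‖ ≤ κ * ‖a‖ := by simpa using h 1 0
  -- the foot of the height on `a` also bounds the area spanned by `a'` and `b'` from above
  set s := ⟪a, b⟫_ℝ / ‖a‖ ^ 2 with hs
  have h2 : ‖b' - s • a'‖ ≤ κ * ‖b - s • a‖ := by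
    have := h (-s) 1
    simpa [neg_smul, neg_add_eq_sub] using this
  have h3 : ‖a‖ ^ 2 * ‖b - s • a‖ ^ 2 = areaSq a b := by
    rw [areaSq, norm_sub_sq_real, norm_smul, inner_smul_right, real_inner_comm a b,
      Real.norm_eq_abs, mul_pow, sq_abs, hs]
    field_simp
    ring
  calc areaSq a' b' ≤ ‖a'‖ ^ 2 * ‖b' - s • a'‖ ^ 2 := areaSq_le_mul _ _ _
    _ ≤ (κ * ‖a‖) ^ 2 * (κ * ‖b - s • a‖) ^ 2 := by gcongr
    _ = (κ ^ 2) ^ 2 * areaSq a b := by rw [← h3]; ring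

theorem abs_mul_area_le (a b : E)
    (α β : ℝ) : |α| * area a b ≤ ‖b‖ * ‖α • a + β • b‖ := by
  refine abs_le_of_sq_le_sq' ?_ (by positivity) |>.2
  rw [mul_pow, sq_abs, area, Real.sq_sqrt (areaSq_nonneg a b), mul_pow, norm_add_sq_real, areaSq]
  simp only [norm_smul, inner_smul_left, inner_smul_right, mul_pow, Real.norm_eq_abs, sq_abs,
    conj_trivial]
  nlinarith [sq_nonneg (α * ⟪a, b⟫_ℝ + β * ‖b‖ ^ 2)]

theorem area_comm (a b : E) :
    area a b = area b a := by
  rw [area, area, areaSq, areaSq, real_inner_comm, mul_comm]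

theorem area_ne_zero {a b : E}
    (h : ∀ α β : ℝ, α • a + β • b = 0 → α = 0 ∧ β = 0) : area a b ≠ 0 := by
  intro h0
  have ha : a ≠ 0 := fun ha => one_ne_zero (h 1 0 (by simp [ha])).1
  have hsq : areaSq a b = 0 := (Real.sqrt_eq_zero (areaSq_nonneg a b)).mp h0
  have hnorm : ‖(-⟪a, b⟫_ℝ) • a + ‖a‖ ^ 2 • b‖ ^ 2 = ‖a‖ ^ 2 * areaSq a b := by
    rw [norm_add_sq_real, areaSq]
    simp only [norm_smul, inner_smul_left, inner_smul_right, mul_pow, Real.norm_eq_abs, sq_abs,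
      conj_trivial]
    ring
  rw [hsq, mul_zero] at hnorm
  have := (h _ _ (norm_eq_zero.mp (pow_eq_zero_iff two_ne_zero |>.mp hnorm))).2
  exact ha (norm_eq_zero.mp (pow_eq_zero_iff two_ne_zero |>.mp this))

theorem abs_area_sub_le {a b a' b' : E} {ε : ℝ} (hε : 0 ≤ ε)
    (h : ∀ α β : ℝ, ‖(α • a' + β • b') - (α • a + β • b)‖ ≤ ε * ‖α • a + β • b‖) :
    |area a' b' - area a b| ≤ (2 * ε + ε ^ 2) * area a b := by
  have hA := area_nonneg a b
  have hA' := area_nonneg a' b'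
  rw [abs_le]
  constructor
  · rcases lt_or_ge ε 1 with h1 | h1
    · have := area_le_of_norm_le (a := a') (b := b') (a' := a) (b' := b) (κ := (1 - ε)⁻¹)
        fun α β => by
          rw [← div_eq_inv_mul, le_div_iff₀ (by linarith)]
          have h2 := h α β
          have h3 := norm_sub_norm_le (α • a + β • b) (α • a' + β • b')
          rw [norm_sub_rev] at h3
          linarith
      rw [inv_pow, ← div_eq_inv_mul, le_div_iff₀ (by nlinarith)] at this
      nlinarith [mul_nonneg (sq_nonneg ε) hA]
    · nlinarith
  · have := area_le_of_norm_le (a := a) (b := b) (a' := a') (b' := b') (κ := 1 + ε)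
      fun α β => by
        have h2 := h α β
        have h3 := norm_sub_norm_le (α • a' + β • b') (α • a + β • b)
        linarith
    linarith [this, show (1 + ε) ^ 2 * area a b = area a b + (2 * ε + ε ^ 2) * area a b by ring]

/-- The squared norm of the tangential gradient times the area element, for a parametrization with
tangent vectors `a`, `b` and a function with the partial derivatives `u` in the parameter plane; see
`norm_gradientVec_sq_mul_area`. -/
noncomputable def energyDensity (a b : E) (u : Fin 2 → ℝ) : ℝ := ‖u 1 • a - u 0 • b‖ ^ 2 / area a b

theorem energyDensity_nonneg (a b : E) (u : Fin 2 → ℝ) : 0 ≤ energyDensity a b u :=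
  div_nonneg (by positivity) (area_nonneg a b)

theorem energyDensity_le {a b a' b' : E} {κ : ℝ} (hab : 0 < area a b)
    (hab' : 0 < area a' b')
    (h : ∀ α β : ℝ, ‖α • a' + β • b'‖ ≤ κ * ‖α • a + β • b‖)
    (h' : ∀ α β : ℝ, ‖α • a + β • b‖ ≤ κ * ‖α • a' + β • b'‖) (u : Fin 2 → ℝ) :
    energyDensity a' b' u ≤ κ ^ 4 * energyDensity a b u := by
  have h1 := area_le_of_norm_le h'
  have h2 : ‖u 1 • a' - u 0 • b'‖ ≤ κ * ‖u 1 • a - u 0 • b‖ := by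
    simpa [neg_smul, ← sub_eq_add_neg] using h (u 1) (-u 0)
  rw [energyDensity, energyDensity, div_le_iff₀ hab']
  calc ‖u 1 • a' - u 0 • b'‖ ^ 2 ≤ (κ * ‖u 1 • a - u 0 • b‖) ^ 2 := by gcongr
    _ = κ ^ 2 * ‖u 1 • a - u 0 • b‖ ^ 2 / area a b * area a b := by
      field_simp
    _ ≤ κ ^ 2 * ‖u 1 • a - u 0 • b‖ ^ 2 / area a b * (κ ^ 2 * area a' b') := by gcongr
    _ = _ := by ring

theorem area_pos_of_sub_le {a b a' b' : E} (hab : 0 < area a b) {ε : ℝ}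
    (hε : ε ≤ 1 / 2)
    (h : ∀ α β : ℝ, ‖(α • a' + β • b') - (α • a + β • b)‖ ≤ ε * ‖α • a + β • b‖) :
    0 < area a' b' := by
  have := area_le_of_norm_le (a := a') (b := b') (a' := a) (b' := b)
    fun α β => norm_le_two_mul_of_sub_le hε (h α β)
  by_contra hc
  have h0 : area a' b' = 0 := le_antisymm (not_lt.mp hc) (area_nonneg _ _)
  rw [h0] at this
  linarith

/-- The constant comes from `(1 + 2 ε)⁴ ≤ 1 + 30 ε` for `ε ≤ 1/2`, where `1 + 2 ε` bounds the ratio of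
the norms in both directions. -/
theorem abs_energyDensity_sub_le {a b a' b' : E} (hab : 0 < area a b) {ε : ℝ} (hε0 : 0 ≤ ε)
    (hε : ε ≤ 1 / 2)
    (h : ∀ α β : ℝ, ‖(α • a' + β • b') - (α • a + β • b)‖ ≤ ε * ‖α • a + β • b‖)
    (u : Fin 2 → ℝ) :
    |energyDensity a' b' u - energyDensity a b u| ≤ 30 * ε * energyDensity a b u := by
  have hab' := area_pos_of_sub_le hab hε h
  have h1 : ∀ α β : ℝ, ‖α • a + β • b‖ ≤ (1 + 2 * ε) * ‖α • a' + β • b'‖ :=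
    fun α β => norm_le_two_mul_of_sub_le hε (h α β)
  have h2 : ∀ α β : ℝ, ‖α • a' + β • b'‖ ≤ (1 + 2 * ε) * ‖α • a + β • b‖ := fun α β => by
    have h3 := norm_sub_norm_le (α • a' + β • b') (α • a + β • b)
    nlinarith [h α β, norm_nonneg (α • a + β • b)]
  have h3 := energyDensity_le hab hab' h2 h1 u
  have h4 := energyDensity_le hab' hab h1 h2 u
  have h5 : (1 + 2 * ε) ^ 4 ≤ 1 + 30 * ε := by
    have : (1 + 2 * ε) ^ 4 = 1 + 8 * ε + 24 * ε ^ 2 + 32 * ε ^ 3 + 16 * ε ^ 4 := by ring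
    have e2 : ε ^ 2 ≤ 1 / 2 * ε := by nlinarith
    have e3 : ε ^ 3 ≤ 1 / 4 * ε := by nlinarith [mul_le_mul_of_nonneg_left e2 hε0]
    have e4 : ε ^ 4 ≤ 1 / 8 * ε := by nlinarith [mul_le_mul_of_nonneg_left e3 hε0]
    linarith
  have hq := energyDensity_nonneg a b u
  have hq' := energyDensity_nonneg a' b' u
  have h6 : energyDensity a' b' u ≤ (1 + 30 * ε) * energyDensity a b u :=
    h3.trans (by gcongr)
  have h7 : energyDensity a b u ≤ (1 + 30 * ε) * energyDensity a' b' u :=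
    h4.trans (by gcongr)
  rw [abs_le]
  constructor
  · rcases le_total (energyDensity a b u) (energyDensity a' b' u) with h8 | h8
    · nlinarith [mul_nonneg hε0 hq]
    · nlinarith [mul_le_mul_of_nonneg_left h8 hε0]
  · linarith

/-- The tangential gradient for a parametrization with tangent vectors `a`, `b` of a function with the
partial derivatives `u` in the parameter plane, written with the adjugate of the Gram matrix. As the
matrix inverse, it is zero where `a` and `b` are linearly dependent. -/
noncomputable def gradientVec (a b : E) (u : Fin 2 → ℝ) : E :=
  (areaSq a b)⁻¹ • ((‖b‖ ^ 2 * u 0 - ⟪a, b⟫_ℝ * u 1) • a + (‖a‖ ^ 2 * u 1 - ⟪a, b⟫_ℝ * u 0) • b)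

theorem norm_gradientVec_sq_mul_area (a b : E) (u : Fin 2 → ℝ) :
    ‖gradientVec a b u‖ ^ 2 * area a b = energyDensity a b u := by
  rcases eq_or_ne (areaSq a b) 0 with h | h
  · simp [area, energyDensity, h]
  have hpos : 0 < areaSq a b := lt_of_le_of_ne (areaSq_nonneg a b) (Ne.symm h)
  have hA : area a b ≠ 0 := (Real.sqrt_pos.mpr hpos).ne'
  have hA2 : area a b * area a b = areaSq a b := Real.mul_self_sqrt hpos.le
  have key : ‖gradientVec a b u‖ ^ 2 * areaSq a b = ‖u 1 • a - u 0 • b‖ ^ 2 := by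
    rw [gradientVec, norm_smul, mul_pow, norm_add_sq_real, norm_sub_sq_real]
    simp only [norm_smul, inner_smul_left, inner_smul_right, mul_pow, Real.norm_eq_abs, sq_abs,
      conj_trivial]
    field_simp
    rw [areaSq]
    ring
  rw [energyDensity, eq_div_iff hA, mul_assoc, hA2, key]

theorem sum_smul_gradientVec {ι : Type} [Fintype ι] (a b : E) (w : ι → ℝ) (u : ι → Fin 2 → ℝ) :
    ∑ i, w i • gradientVec a b (u i) = gradientVec a b (∑ i, w i • u i) := by
  simp only [gradientVec, smul_smul, smul_add, Finset.sum_add_distrib, ← Finset.sum_smul,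
    Finset.sum_apply, Pi.smul_apply, smul_eq_mul, Finset.mul_sum, ← Finset.sum_sub_distrib,
    mul_sub]
  congr 1 <;> congr 1 <;> exact Finset.sum_congr rfl fun i _ => by ring

end Area

/-! ### Mass and stiffness matrices as elementwise integrals -/

namespace Triangulation

variable {Γ : Set E3} {k : ℕ} (𝒯 : Triangulation Γ k)

theorem fderiv_pullback_apply {V : Type} [NormedAddCommGroup V] [NormedSpace ℝ V]
    (w : Fin 𝒯.numNodes → V) (e : Fin 𝒯.numElements) (ξ : E2) (i : Fin 2) :
    fderiv ℝ (𝒯.pullback w e) ξ (EuclideanSpace.single i 1) =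
      ∑ a, lagrangeDeriv k a ξ i • w (𝒯.nodeIndex e a) := by
  have : HasFDerivAt (𝒯.pullback w e) (∑ a : LagrangeIndex k,
      (fderiv ℝ (lagrangeBasis k a) ξ).smulRight (w (𝒯.nodeIndex e a))) ξ :=
    HasFDerivAt.fun_sum fun a _ =>
      ((differentiable_lagrangeBasis k a) ξ).hasFDerivAt.smul_const _
  rw [this.fderiv]
  simp [lagrangeDeriv]

theorem tangent_eq_sum (x : Fin 𝒯.numNodes → E3) (e : Fin 𝒯.numElements) (ξ : E2) (i : Fin 2) :
    𝒯.tangent x e ξ i = ∑ a, lagrangeDeriv k a ξ i • x (𝒯.nodeIndex e a) :=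
  𝒯.fderiv_pullback_apply x e ξ i

theorem continuous_tangent (x : Fin 𝒯.numNodes → E3) (e : Fin 𝒯.numElements) (i : Fin 2) :
    Continuous fun ξ => 𝒯.tangent x e ξ i := by
  simp only [tangent_eq_sum]
  exact continuous_finsetSum _ fun a _ => (continuous_lagrangeDeriv k a i).smul continuous_const

theorem det_gram (x : Fin 𝒯.numNodes → E3) (e : Fin 𝒯.numElements) (ξ : E2) :
    (𝒯.gram x e ξ).det = areaSq (𝒯.tangent x e ξ 0) (𝒯.tangent x e ξ 1) := by
  rw [Matrix.det_fin_two]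
  simp only [gram, Matrix.of_apply, areaSq, real_inner_self_eq_norm_sq]
  rw [real_inner_comm (𝒯.tangent x e ξ 0)]
  ring

theorem sqrt_det_gram (x : Fin 𝒯.numNodes → E3) (e : Fin 𝒯.numElements) (ξ : E2) :
    Real.sqrt (𝒯.gram x e ξ).det = area (𝒯.tangent x e ξ 0) (𝒯.tangent x e ξ 1) := by
  rw [det_gram, area]

theorem tangentialGradient_eq (x : Fin 𝒯.numNodes → E3) (e : Fin 𝒯.numElements) (u : E2 → ℝ)
    (ξ : E2) : 𝒯.tangentialGradient x e u ξ =
      gradientVec (𝒯.tangent x e ξ 0) (𝒯.tangent x e ξ 1)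
        fun i => fderiv ℝ u ξ (EuclideanSpace.single i 1) := by
  rw [tangentialGradient, Matrix.inv_def, Ring.inverse_eq_inv', det_gram]
  simp only [Matrix.smul_apply, Matrix.adjugate_fin_two, gram, Matrix.of_apply, smul_eq_mul,
    Fin.sum_univ_two, Matrix.cons_val', Matrix.cons_val_zero, Matrix.cons_val_one,
    Matrix.cons_val_fin_one, real_inner_self_eq_norm_sq, gradientVec]
  rw [real_inner_comm (𝒯.tangent x e ξ 0) (𝒯.tangent x e ξ 1)]
  module

theorem continuous_area (x : Fin 𝒯.numNodes → E3) (e : Fin 𝒯.numElements) :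
    Continuous fun ξ => area (𝒯.tangent x e ξ 0) (𝒯.tangent x e ξ 1) := by
  have h0 := 𝒯.continuous_tangent x e 0
  have h1 := 𝒯.continuous_tangent x e 1
  unfold area areaSq
  exact (((h0.norm.pow 2).mul (h1.norm.pow 2)).sub ((h0.inner h1).pow 2)).sqrt

theorem dotProduct_mulVec_surfaceIntegral (x : Fin 𝒯.numNodes → E3)
    (B : Fin 𝒯.numNodes → Fin 𝒯.numNodes → Fin 𝒯.numElements → E2 → ℝ)
    (hB : ∀ i j e, IntegrableOn (fun ξ => B i j e ξ * Real.sqrt (𝒯.gram x e ξ).det) refTriangle)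
    (w : Fin 𝒯.numNodes → ℝ) :
    dotProduct w ((Matrix.of fun i j => 𝒯.surfaceIntegral x (B i j)).mulVec w) =
      𝒯.surfaceIntegral x fun e ξ => ∑ i, ∑ j, w i * w j * B i j e ξ := by
  simp only [dotProduct, Matrix.mulVec, Matrix.of_apply, surfaceIntegral]
  have h : ∀ e, ∫ ξ in refTriangle, (∑ i, ∑ j, w i * w j * B i j e ξ) *
      Real.sqrt (𝒯.gram x e ξ).det =
      ∑ i, ∑ j, w i * w j * ∫ ξ in refTriangle, B i j e ξ * Real.sqrt (𝒯.gram x e ξ).det := by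
    intro e
    simp only [Finset.sum_mul, mul_assoc (w _ * w _)]
    rw [integral_finsetSum _ fun i _ => integrable_finsetSum _ fun j _ =>
      (hB i j e).const_mul _]
    refine Finset.sum_congr rfl fun i _ => ?_
    rw [integral_finsetSum _ fun j _ => (hB i j e).const_mul _]
    exact Finset.sum_congr rfl fun j _ => integral_const_mul _ _
  simp only [h]
  rw [Finset.sum_comm]
  refine Finset.sum_congr rfl fun i _ => ?_
  rw [Finset.sum_comm, Finset.mul_sum]
  refine Finset.sum_congr rfl fun j _ => ?_
  rw [Finset.sum_mul, Finset.mul_sum]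
  exact Finset.sum_congr rfl fun e _ => by ring

theorem continuous_pullback (w : Fin 𝒯.numNodes → ℝ) (e : Fin 𝒯.numElements) :
    Continuous (𝒯.pullback w e) := by
  unfold pullback
  exact continuous_finsetSum _ fun a _ =>
    (differentiable_lagrangeBasis k a).continuous.smul continuous_const

theorem pullback_eq_sum_basisFun (w : Fin 𝒯.numNodes → ℝ) (e : Fin 𝒯.numElements) (ξ : E2) :
    𝒯.pullback w e ξ = ∑ j, w j * 𝒯.basisFun j e ξ := by
  simp only [basisFun, pullback, smul_eq_mul, Finset.mul_sum]
  rw [Finset.sum_comm]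
  refine Finset.sum_congr rfl fun a _ => ?_
  simp [Pi.single_apply, mul_comm]

theorem dotProduct_massMatrix (x : Fin 𝒯.numNodes → E3) (w : Fin 𝒯.numNodes → ℝ) :
    dotProduct w ((𝒯.massMatrix x).mulVec w) = ∑ e, ∫ ξ in refTriangle,
      𝒯.pullback w e ξ ^ 2 * area (𝒯.tangent x e ξ 0) (𝒯.tangent x e ξ 1) := by
  rw [massMatrix, dotProduct_mulVec_surfaceIntegral]
  · simp only [surfaceIntegral, sqrt_det_gram]
    refine Finset.sum_congr rfl fun e _ => ?_
    congr 1
    funext ξ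
    congr 1
    rw [pullback_eq_sum_basisFun, sq, Finset.sum_mul_sum]
    exact Finset.sum_congr rfl fun i _ => Finset.sum_congr rfl fun j _ => by ring
  · intro i j e
    simp only [sqrt_det_gram]
    exact (((𝒯.continuous_pullback _ e).mul (𝒯.continuous_pullback _ e)).mul
      (𝒯.continuous_area x e)).continuousOn.integrableOn_compact isCompact_refTriangle

/-- The partial derivatives on the reference triangle of the finite element function with the nodal
values `w`. -/
noncomputable def refGradient (w : Fin 𝒯.numNodes → ℝ) (e : Fin 𝒯.numElements) (ξ : E2) :
    Fin 2 → ℝ :=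
  fun i => fderiv ℝ (𝒯.pullback w e) ξ (EuclideanSpace.single i 1)

theorem continuous_refGradient (w : Fin 𝒯.numNodes → ℝ) (e : Fin 𝒯.numElements) (i : Fin 2) :
    Continuous fun ξ => 𝒯.refGradient w e ξ i := by
  simp only [refGradient, fderiv_pullback_apply]
  exact continuous_finsetSum _ fun a _ => (continuous_lagrangeDeriv k a i).smul continuous_const

theorem refGradient_eq_sum (w : Fin 𝒯.numNodes → ℝ) (e : Fin 𝒯.numElements) (ξ : E2) :
    𝒯.refGradient w e ξ = ∑ j, w j • 𝒯.refGradient (Pi.single j 1) e ξ := by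
  funext i
  simp only [refGradient, fderiv_pullback_apply, smul_eq_mul, Finset.sum_apply, Pi.smul_apply,
    Finset.mul_sum]
  rw [Finset.sum_comm]
  refine Finset.sum_congr rfl fun a _ => ?_
  simp [Pi.single_apply, mul_comm]

/-- The parametrizations of the elements of `Γ_h[x]` are immersions on the reference triangle. -/
def Nondegenerate (x : Fin 𝒯.numNodes → E3) : Prop :=
  ∀ e, ∀ ξ ∈ refTriangle, 0 < area (𝒯.tangent x e ξ 0) (𝒯.tangent x e ξ 1)

variable {𝒯}

theorem Nondegenerate.areaSq_ne_zero {x : Fin 𝒯.numNodes → E3} (hx : 𝒯.Nondegenerate x)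
    (e : Fin 𝒯.numElements) {ξ : E2} (hξ : ξ ∈ refTriangle) :
    areaSq (𝒯.tangent x e ξ 0) (𝒯.tangent x e ξ 1) ≠ 0 :=
  (Real.sqrt_pos.mp (hx e ξ hξ)).ne'

theorem Nondegenerate.continuousOn_gradientVec {x : Fin 𝒯.numNodes → E3}
    (hx : 𝒯.Nondegenerate x) (e : Fin 𝒯.numElements) (w : Fin 𝒯.numNodes → ℝ) :
    ContinuousOn (fun ξ => gradientVec (𝒯.tangent x e ξ 0) (𝒯.tangent x e ξ 1)
      (𝒯.refGradient w e ξ)) refTriangle := by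
  have h0 := 𝒯.continuous_tangent x e 0
  have h1 := 𝒯.continuous_tangent x e 1
  have u0 := 𝒯.continuous_refGradient w e 0
  have u1 := 𝒯.continuous_refGradient w e 1
  have hA : Continuous fun ξ => areaSq (𝒯.tangent x e ξ 0) (𝒯.tangent x e ξ 1) :=
    ((h0.norm.pow 2).mul (h1.norm.pow 2)).sub ((h0.inner h1).pow 2)
  unfold gradientVec
  refine (hA.continuousOn.inv₀ fun ξ hξ => hx.areaSq_ne_zero e hξ).smul (Continuous.continuousOn ?_)
  exact ((((h1.norm.pow 2).mul u0).sub ((h0.inner h1).mul u1)).smul h0).add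
    ((((h0.norm.pow 2).mul u1).sub ((h0.inner h1).mul u0)).smul h1)

theorem Nondegenerate.dotProduct_stiffnessMatrix {x : Fin 𝒯.numNodes → E3}
    (hx : 𝒯.Nondegenerate x) (w : Fin 𝒯.numNodes → ℝ) :
    dotProduct w ((𝒯.stiffnessMatrix x).mulVec w) = ∑ e, ∫ ξ in refTriangle,
      energyDensity (𝒯.tangent x e ξ 0) (𝒯.tangent x e ξ 1) (𝒯.refGradient w e ξ) := by
  rw [stiffnessMatrix, dotProduct_mulVec_surfaceIntegral]
  · simp only [surfaceIntegral, sqrt_det_gram]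
    refine Finset.sum_congr rfl fun e _ => ?_
    congr 1
    funext ξ
    rw [← norm_gradientVec_sq_mul_area, refGradient_eq_sum, ← sum_smul_gradientVec,
      ← real_inner_self_eq_norm_sq, sum_inner]
    simp only [inner_sum, tangentialGradient_eq, inner_smul_left, inner_smul_right,
      conj_trivial]
    congr 1
    refine Finset.sum_congr rfl fun i _ => Finset.sum_congr rfl fun j _ => ?_
    rw [mul_comm (w i) (w j), mul_assoc]
    rfl
  · intro i j e
    simp only [sqrt_det_gram, tangentialGradient_eq]
    exact (((hx.continuousOn_gradientVec e _).inner (hx.continuousOn_gradientVec e _)).mul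
      (𝒯.continuous_area x e).continuousOn).integrableOn_compact isCompact_refTriangle

theorem Nondegenerate.continuousOn_energyDensity {x : Fin 𝒯.numNodes → E3}
    (hx : 𝒯.Nondegenerate x) (e : Fin 𝒯.numElements) (w : Fin 𝒯.numNodes → ℝ) :
    ContinuousOn (fun ξ => energyDensity (𝒯.tangent x e ξ 0) (𝒯.tangent x e ξ 1)
      (𝒯.refGradient w e ξ)) refTriangle := by
  simp only [← norm_gradientVec_sq_mul_area]
  exact ((hx.continuousOn_gradientVec e w).norm.pow 2).mul (𝒯.continuous_area x e).continuousOn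

end Triangulation

/-! ### Extrapolation coefficients -/

theorem coeff_one_sub_X_pow {p m : ℕ} (hm : m ≤ p) :
    ((1 - (Polynomial.X : Polynomial ℝ)) ^ p).coeff m = (-1) ^ m * p.choose m := by
  have h : (1 - (Polynomial.X : Polynomial ℝ)) ^ p =
      Polynomial.C ((-1) ^ p) * (Polynomial.X + Polynomial.C (-1)) ^ p := by
    rw [map_pow, ← mul_pow]
    congr 1
    rw [map_neg, map_one]
    ring
  rw [h, Polynomial.coeff_C_mul, Polynomial.coeff_X_add_C_pow, ← mul_assoc, ← pow_add,
    show p + (p - m) = m + 2 * (p - m) by omega, pow_add, pow_mul]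
  simp

theorem extrapolationCoeff_eq {p j : ℕ} (hj : j < p) :
    extrapolationCoeff p j = -((-1) ^ (j + 1) * p.choose (j + 1)) := by
  rw [extrapolationCoeff, Polynomial.coeff_divX, Polynomial.coeff_sub, coeff_one_sub_X_pow hj,
    Polynomial.coeff_one]
  simp

/-- The extrapolation error is a difference of order `p`, because `1 - ζ γ(ζ) = (1 - ζ)^p`. -/
theorem sum_extrapolationCoeff_sub (p n : ℕ) (τ : ℝ) (g : ℝ → E3) :
    ∑ j ∈ Finset.range p, extrapolationCoeff p j • g (((n : ℝ) - 1 - j) * τ) - g (n * τ) =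
      -(fwdDiff τ)^[p] g (((n : ℝ) - p) * τ) := by
  rw [fwdDiff_iter_eq_sum_shift, ← Finset.sum_range_reflect _ (p + 1),
    Finset.sum_range_succ']
  rw [neg_add, sub_eq_add_neg, ← Finset.sum_neg_distrib]
  congr 1
  · refine Finset.sum_congr rfl fun j hj => ?_
    have hj' : j + 1 ≤ p := Finset.mem_range.mp hj
    rw [extrapolationCoeff_eq hj', ← Int.cast_smul_eq_zsmul ℝ, ← neg_smul]
    congr 1
    · rw [show p + 1 - 1 - (j + 1) = p - (j + 1) by omega, Nat.sub_sub_self hj',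
        Nat.choose_symm hj']
      push_cast
      ring
    · rw [nsmul_eq_mul, show p + 1 - 1 - (j + 1) = p - (j + 1) by omega, Nat.cast_sub hj']
      push_cast
      congr 1
      ring
  · simp
    congr 1
    ring

/-! ### Flat triangles -/

theorem dist_le_diam_triangle (v : Fin 3 → E3) {x y : E3} (hx : x ∈ triangle v)
    (hy : y ∈ triangle v) : dist x y ≤ Metric.diam (triangle v) :=
  Metric.dist_le_diam_of_mem (isBounded_convexHull.mpr (finite_range v).isBounded) hx hy

theorem vertex_mem_triangle (v : Fin 3 → E3) (i : Fin 3) : v i ∈ triangle v :=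
  subset_convexHull ℝ _ (mem_range_self i)

theorem diam_triangle_le_perimeter (v : Fin 3 → E3) : Metric.diam (triangle v) ≤
    dist (v 0) (v 1) + dist (v 1) (v 2) + dist (v 2) (v 0) := by
  rw [triangle, convexHull_diam]
  refine Metric.diam_le_of_forall_dist_le (by positivity) ?_
  have h01 : 0 ≤ dist (v 0) (v 1) := dist_nonneg
  have h12 : 0 ≤ dist (v 1) (v 2) := dist_nonneg
  have h20 : 0 ≤ dist (v 2) (v 0) := dist_nonneg
  have c1 := dist_comm (v 0) (v 1)
  have c2 := dist_comm (v 1) (v 2)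
  have c3 := dist_comm (v 2) (v 0)
  rintro _ ⟨i, rfl⟩ _ ⟨j, rfl⟩
  fin_cases i <;> fin_cases j <;> simp <;> linarith

/-- Shape regularity bounds linear combinations of the edge vectors from below. The inradius bound
gives `area ≥ d² / σ`, and `|α| · area` is at most the length of the second edge times
`‖α • a + β • b‖`. -/
theorem diam_mul_le_norm_of_shapeRegular {v : Fin 3 → E3} {σ : ℝ} (hσ : 0 < σ)
    (hd : 0 < Metric.diam (triangle v))
    (h : Metric.diam (triangle v) ≤ σ * inradius v) (α β : ℝ) :
    Metric.diam (triangle v) * (|α| + |β|) ≤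
      2 * σ * ‖α • (v 1 - v 0) + β • (v 2 - v 0)‖ := by
  set d := Metric.diam (triangle v) with hd_def
  have hper := diam_triangle_le_perimeter v
  have harea : d ^ 2 ≤ σ * area (v 1 - v 0) (v 2 - v 0) := by
    rw [inradius, ← mul_div_assoc, le_div_iff₀ (hd.trans_le hper)] at h
    calc d ^ 2 = d * d := sq d
      _ ≤ d * _ := mul_le_mul_of_nonneg_left hper hd.le
      _ ≤ _ := h
  have h1 : ‖v 1 - v 0‖ ≤ d := by
    rw [← dist_eq_norm]
    exact dist_le_diam_triangle v (vertex_mem_triangle v 1) (vertex_mem_triangle v 0)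
  have h2 : ‖v 2 - v 0‖ ≤ d := by
    rw [← dist_eq_norm]
    exact dist_le_diam_triangle v (vertex_mem_triangle v 2) (vertex_mem_triangle v 0)
  set a := v 1 - v 0
  set b := v 2 - v 0
  have hα := abs_mul_area_le a b α β
  have hβ := abs_mul_area_le b a β α
  rw [area_comm b a, add_comm (β • b)] at hβ
  set W := ‖α • a + β • b‖
  have hW : 0 ≤ W := norm_nonneg _
  have key : ∀ γ c : ℝ, |γ| * area a b ≤ c * W → c ≤ d → d * |γ| ≤ σ * W := by
    intro γ c hγ hc
    have : d * (d * |γ|) ≤ d * (σ * W) := by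
      calc d * (d * |γ|) = |γ| * d ^ 2 := by ring
        _ ≤ |γ| * (σ * area a b) := by gcongr
        _ = σ * (|γ| * area a b) := by ring
        _ ≤ σ * (d * W) :=
          mul_le_mul_of_nonneg_left (hγ.trans (mul_le_mul_of_nonneg_right hc hW)) hσ.le
        _ = d * (σ * W) := by ring
    exact le_of_mul_le_mul_left this hd
  linarith [key α _ hα h2, key β _ hβ h1]

theorem diam_triangle_pos {v : Fin 3 → E3} (hv : AffineIndependent ℝ v) :
    0 < Metric.diam (triangle v) := by
  have h : 0 < dist (v 0) (v 1) := dist_pos.mpr (hv.injective.ne (by decide))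
  exact h.trans_le
    (dist_le_diam_triangle v (vertex_mem_triangle v 0) (vertex_mem_triangle v 1))

theorem sum_lagrangeIndex_div {k : ℕ} (hk : 1 ≤ k) (a : LagrangeIndex k) :
    ∑ m, ((a.1 m : ℕ) : ℝ) / k = 1 := by
  have hk' : (k : ℝ) ≠ 0 := by positivity
  rw [← Finset.sum_div, ← Nat.cast_sum, a.2, div_self hk']

theorem norm_sum_lagrangeIndex_smul_le {k : ℕ} (hk : 1 ≤ k) (a : LagrangeIndex k)
    {y : Fin 3 → E3} {δ : ℝ} (hy : ∀ m, ‖y m‖ ≤ δ) :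
    ‖∑ m, (((a.1 m : ℕ) : ℝ) / k) • y m‖ ≤ δ := by
  calc ‖∑ m, (((a.1 m : ℕ) : ℝ) / k) • y m‖ ≤ ∑ m, (((a.1 m : ℕ) : ℝ) / k) * δ := by
        refine norm_sum_le_of_le _ fun m _ => ?_
        rw [norm_smul, Real.norm_of_nonneg (by positivity)]
        exact mul_le_mul_of_nonneg_left (hy m) (by positivity)
    _ = δ := by rw [← Finset.sum_mul, sum_lagrangeIndex_div hk, one_mul]

/-! ### Tangent vectors of the elements -/

namespace Triangulation

variable {Γ : Set E3} {k : ℕ} (𝒯 : Triangulation Γ k)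

theorem diam_le_meshWidth (e : Fin 𝒯.numElements) :
    Metric.diam (triangle (𝒯.vertex e)) ≤ 𝒯.meshWidth :=
  le_ciSup (f := fun e => Metric.diam (triangle (𝒯.vertex e))) (finite_range _).bddAbove e

theorem flatNode_sub_vertex (hk : 1 ≤ k) (e : Fin 𝒯.numElements) (a : LagrangeIndex k) :
    𝒯.flatNode (𝒯.nodeIndex e a) - 𝒯.vertex e 0 =
      ∑ m, (((a.1 m : ℕ) : ℝ) / k) • (𝒯.vertex e m - 𝒯.vertex e 0) := by
  simp only [smul_sub, Finset.sum_sub_distrib, ← Finset.sum_smul, sum_lagrangeIndex_div hk,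
    one_smul, 𝒯.flatNode_nodeIndex]

variable {T : ℝ} {X : E3 → ℝ → E3} {p : ℕ} {ρ C : ℝ}

/-- The nodes are `O(d²)` close to the Lagrange points of the flat triangle. -/
theorem node_bounds (hk : 1 ≤ k) (hC : 1 ≤ C)
    (hloc : ∀ v ∈ Γ, LocalBounds Γ T X p ρ C v) (e : Fin 𝒯.numElements)
    {d : ℝ} (hd : d = Metric.diam (triangle (𝒯.vertex e))) (hdC : 2 * C * d ≤ 1)
    (hdρ : 2 * d ≤ ρ) (a : LagrangeIndex k) :
    ‖𝒯.node (𝒯.nodeIndex e a) - 𝒯.flatNode (𝒯.nodeIndex e a)‖ ≤ 2 * C * d ^ 2 ∧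
    ‖𝒯.node (𝒯.nodeIndex e a) - 𝒯.vertex e 0‖ ≤ 2 * d := by
  have hd0 : 0 ≤ d := hd ▸ Metric.diam_nonneg
  obtain ⟨P, hP, hdist, -, -⟩ := hloc _ (𝒯.vertex_mem e 0)
  have hv : ∀ m, ‖𝒯.vertex e m - 𝒯.vertex e 0‖ ≤ d := fun m => by
    rw [← dist_eq_norm, hd]
    exact dist_le_diam_triangle _ (vertex_mem_triangle _ m) (vertex_mem_triangle _ 0)
  have hflat : ‖𝒯.flatNode (𝒯.nodeIndex e a) - 𝒯.vertex e 0‖ ≤ d := by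
    rw [𝒯.flatNode_sub_vertex hk]
    exact norm_sum_lagrangeIndex_smul_le hk a hv
  have hPflat : ‖𝒯.flatNode (𝒯.nodeIndex e a) - 𝒯.vertex e 0 -
      P (𝒯.flatNode (𝒯.nodeIndex e a) - 𝒯.vertex e 0)‖ ≤ C * d ^ 2 := by
    rw [𝒯.flatNode_sub_vertex hk, map_sum, ← Finset.sum_sub_distrib]
    simp only [map_smul, ← smul_sub]
    refine norm_sum_lagrangeIndex_smul_le hk a fun m => ?_
    have := hP _ (𝒯.vertex_mem e m) (by rw [dist_eq_norm]; linarith [hv m])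
    exact this.trans (by gcongr; exact hv m)
  have h1 := hdist (𝒯.flatNode (𝒯.nodeIndex e a)) (by rw [dist_eq_norm]; linarith)
  have h2 : ‖𝒯.node (𝒯.nodeIndex e a) - 𝒯.flatNode (𝒯.nodeIndex e a)‖ ≤ 2 * C * d ^ 2 := by
    rw [← dist_eq_norm, dist_comm, (𝒯.node_closest _).2]
    have : C * ‖𝒯.flatNode (𝒯.nodeIndex e a) - 𝒯.vertex e 0‖ ^ 2 ≤ C * d ^ 2 := by gcongr
    linarith
  refine ⟨h2, ?_⟩
  have h3 := norm_add_le (𝒯.node (𝒯.nodeIndex e a) - 𝒯.flatNode (𝒯.nodeIndex e a))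
    (𝒯.flatNode (𝒯.nodeIndex e a) - 𝒯.vertex e 0)
  rw [sub_add_sub_cancel] at h3
  nlinarith

/-- The tangent vectors of `Γ_h[x_*(t)]` are linearly independent with a lower bound proportional to the
diameter `d` of the element. The condition `hdσ` on `d` allows absorbing the remainder, which is
`O(d²)`. -/
theorem diam_mul_le_norm_tangent (hk : 1 ≤ k) (hC : 1 ≤ C)
    (hloc : ∀ v ∈ Γ, LocalBounds Γ T X p ρ C v) {σ : ℝ} (hσ : 1 ≤ σ) {K : ℝ}
    (hK : ∀ ξ ∈ refTriangle, ∀ i, ∑ a, |lagrangeDeriv k a ξ i| ≤ K)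
    (e : Fin 𝒯.numElements)
    {d : ℝ} (hd : d = Metric.diam (triangle (𝒯.vertex e)))
    (hshape : d ≤ σ * inradius (𝒯.vertex e)) (hdC : 2 * C * d ≤ 1) (hdρ : 2 * d ≤ ρ)
    (hdσ : 4 * σ * (C ^ 2 + K * C ^ 2 * (4 + 2 * C)) * d ≤ 1)
    {t : ℝ} (ht : t ∈ Icc 0 T) {ξ : E2} (hξ : ξ ∈ refTriangle) (α β : ℝ) :
    d * (|α| + |β|) ≤ 4 * σ * C * ‖α • 𝒯.tangent (𝒯.exactNodes X t) e ξ 0 +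
      β • 𝒯.tangent (𝒯.exactNodes X t) e ξ 1‖ := by
  have hd0 : 0 ≤ d := hd ▸ Metric.diam_nonneg
  have hdpos : 0 < d := hd ▸ diam_triangle_pos (𝒯.affineIndependent e)
  obtain ⟨P, hP, -, hX, -⟩ := hloc _ (𝒯.vertex_mem e 0)
  obtain ⟨L, hLC, hLinj, hL⟩ := hX t ht
  have hv : ∀ m, ‖𝒯.vertex e m - 𝒯.vertex e 0‖ ≤ d := fun m => by
    rw [← dist_eq_norm, hd]
    exact dist_le_diam_triangle _ (vertex_mem_triangle _ m) (vertex_mem_triangle _ 0)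
  -- the remainder of the linearization at the nodes
  let r : LagrangeIndex k → E3 := fun a => X (𝒯.node (𝒯.nodeIndex e a)) t - X (𝒯.vertex e 0) t -
    L (𝒯.flatNode (𝒯.nodeIndex e a) - 𝒯.vertex e 0)
  have hr : ∀ a, ‖r a‖ ≤ C * (4 + 2 * C) * d ^ 2 := by
    intro a
    obtain ⟨h1, h2⟩ := 𝒯.node_bounds hk hC hloc e hd hdC hdρ a
    have h3 := hL _ (𝒯.node_closest (𝒯.nodeIndex e a)).1 (by rw [dist_eq_norm]; linarith)
    have h4 : r a = (X (𝒯.node (𝒯.nodeIndex e a)) t - X (𝒯.vertex e 0) t -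
        L (𝒯.node (𝒯.nodeIndex e a) - 𝒯.vertex e 0)) +
        L (𝒯.node (𝒯.nodeIndex e a) - 𝒯.flatNode (𝒯.nodeIndex e a)) := by
      simp only [r, map_sub]
      abel
    rw [h4]
    refine (norm_add_le _ _).trans ?_
    have h5 : ‖L (𝒯.node (𝒯.nodeIndex e a) - 𝒯.flatNode (𝒯.nodeIndex e a))‖ ≤
        C * (2 * C * d ^ 2) := (L.le_opNorm _).trans (by gcongr)
    have h6 : C * ‖𝒯.node (𝒯.nodeIndex e a) - 𝒯.vertex e 0‖ ^ 2 ≤ C * (2 * d) ^ 2 := by gcongr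
    linarith [show C * (4 + 2 * C) * d ^ 2 = C * (2 * d) ^ 2 + C * (2 * C * d ^ 2) by ring]
  have htan : ∀ i : Fin 2, 𝒯.tangent (𝒯.exactNodes X t) e ξ i =
      L (𝒯.vertex e i.succ - 𝒯.vertex e 0) + ∑ a, lagrangeDeriv k a ξ i • r a := by
    intro i
    have h1 : ∀ a, lagrangeDeriv k a ξ i • 𝒯.exactNodes X t (𝒯.nodeIndex e a) =
        lagrangeDeriv k a ξ i • r a + lagrangeDeriv k a ξ i • X (𝒯.vertex e 0) t +
        (L (lagrangeDeriv k a ξ i • 𝒯.flatNode (𝒯.nodeIndex e a)) -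
          lagrangeDeriv k a ξ i • L (𝒯.vertex e 0)) := by
      intro a
      simp only [r, exactNodes, map_smul, map_sub]
      module
    rw [tangent_eq_sum]
    simp only [h1, Finset.sum_add_distrib, Finset.sum_sub_distrib, ← Finset.sum_smul,
      sum_lagrangeDeriv, zero_smul, ← map_sum, 𝒯.flatNode_nodeIndex,
      sum_lagrangeDeriv_smul_affine k hk]
    abel
  have hrem : ∀ i : Fin 2, ‖∑ a, lagrangeDeriv k a ξ i • r a‖ ≤
      K * (C * (4 + 2 * C) * d ^ 2) := fun i =>
    norm_sum_lagrangeDeriv_smul_le (hK ξ hξ i) (by positivity) hr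
  set w := α • (𝒯.vertex e 1 - 𝒯.vertex e 0) + β • (𝒯.vertex e 2 - 𝒯.vertex e 0) with hw
  set R := α • ∑ a, lagrangeDeriv k a ξ 0 • r a + β • ∑ a, lagrangeDeriv k a ξ 1 • r a with hR
  have hcomb : α • 𝒯.tangent (𝒯.exactNodes X t) e ξ 0 +
      β • 𝒯.tangent (𝒯.exactNodes X t) e ξ 1 = L w + R := by
    rw [htan, htan, hw, hR]
    simp only [Fin.succ_zero_eq_one, Fin.succ_one_eq_two, map_add, map_smul]
    module
  have hcombo_norm : ∀ (y z : E3) (δ : ℝ), ‖y‖ ≤ δ → ‖z‖ ≤ δ →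
      ‖α • y + β • z‖ ≤ (|α| + |β|) * δ := by
    intro y z δ hy hz
    refine (norm_add_le _ _).trans ?_
    rw [norm_smul, norm_smul, Real.norm_eq_abs, Real.norm_eq_abs, add_mul]
    gcongr
  have hRn := hcombo_norm _ _ _ (hrem 0) (hrem 1)
  rw [← hR] at hRn
  have hPw : ‖w - P w‖ ≤ (|α| + |β|) * (C * d ^ 2) := by
    have : w - P w = α • ((𝒯.vertex e 1 - 𝒯.vertex e 0) - P (𝒯.vertex e 1 - 𝒯.vertex e 0)) +
        β • ((𝒯.vertex e 2 - 𝒯.vertex e 0) - P (𝒯.vertex e 2 - 𝒯.vertex e 0)) := by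
      rw [hw, map_add, map_smul, map_smul]
      module
    rw [this]
    refine hcombo_norm _ _ _ ?_ ?_
    · refine (hP _ (𝒯.vertex_mem e 1) (by rw [dist_eq_norm]; linarith [hv 1])).trans ?_
      gcongr
      exact hv 1
    · refine (hP _ (𝒯.vertex_mem e 2) (by rw [dist_eq_norm]; linarith [hv 2])).trans ?_
      gcongr
      exact hv 2
  have hshape' := diam_mul_le_norm_of_shapeRegular (v := 𝒯.vertex e) (by linarith)
    (hd ▸ hdpos) (hd ▸ hshape) α β
  rw [← hd, ← hw] at hshape'
  have hwL := hLinj w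
  have hLw : ‖L w‖ ≤ ‖L w + R‖ + ‖R‖ := by
    have := norm_sub_le (L w + R) R
    rwa [add_sub_cancel_right] at this
  rw [hcomb]
  set s := |α| + |β| with hs
  have hs0 : 0 ≤ s := by positivity
  -- by `h8` the terms of order `s d²` are at most half of `s d`
  have hfin : ‖w‖ ≤ C * (‖L w + R‖ + s * (K * (C * (4 + 2 * C) * d ^ 2)) + s * (C * d ^ 2)) :=
    hwL.trans (by gcongr; linarith)
  have h7 : 2 * σ * ‖w‖ ≤ 2 * σ *
      (C * (‖L w + R‖ + s * (K * (C * (4 + 2 * C) * d ^ 2)) + s * (C * d ^ 2))) := by gcongr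
  have h8 : s * d * (4 * σ * (C ^ 2 + K * C ^ 2 * (4 + 2 * C)) * d) ≤ s * d * 1 := by gcongr
  nlinarith

theorem extrapolatedNodes_sub_exactNodes (p n : ℕ) (τ : ℝ)
    (j : Fin 𝒯.numNodes) :
    𝒯.extrapolatedNodes X p τ n j - 𝒯.exactNodes X (n * τ) j =
      -(fwdDiff τ)^[p] (X (𝒯.node j)) (((n : ℝ) - p) * τ) := by
  rw [← sum_extrapolationCoeff_sub p n]
  simp [extrapolatedNodes, exactNodes, Finset.sum_apply]

/-- The tangent vectors of the extrapolated and the exact element differ by `O(τ^p d)`. The vertex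
`v₀` of the element serves as the reference point, which may be subtracted since the derivatives of
the Lagrange basis sum up to zero. -/
theorem norm_tangent_sub_le (hk : 1 ≤ k) (hC : 1 ≤ C)
    (hloc : ∀ v ∈ Γ, LocalBounds Γ T X p ρ C v) {K : ℝ}
    (hK : ∀ ξ ∈ refTriangle, ∀ i, ∑ a, |lagrangeDeriv k a ξ i| ≤ K)
    (e : Fin 𝒯.numElements)
    {d : ℝ} (hd : d = Metric.diam (triangle (𝒯.vertex e))) (hdC : 2 * C * d ≤ 1)
    (hdρ : 2 * d ≤ ρ) {τ : ℝ} {n : ℕ} (hτ : 0 < τ) (hpn : p ≤ n) (hnT : n * τ ≤ T)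
    {ξ : E2} (hξ : ξ ∈ refTriangle) (i : Fin 2) :
    ‖𝒯.tangent (𝒯.extrapolatedNodes X p τ n) e ξ i - 𝒯.tangent (𝒯.exactNodes X (n * τ)) e ξ i‖ ≤
      K * (2 * C * τ ^ p * d) := by
  have hd0 : 0 ≤ d := hd ▸ Metric.diam_nonneg
  have hpn' : (p : ℝ) ≤ n := by exact_mod_cast hpn
  obtain ⟨P, -, -, -, hdiff⟩ := hloc _ (𝒯.vertex_mem e 0)
  set s : ℝ := ((n : ℝ) - p) * τ with hs
  have hs0 : 0 ≤ s := mul_nonneg (by linarith) hτ.le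
  have hsT : s + p * τ ≤ T := by rw [hs]; linarith
  have h1 : 𝒯.tangent (𝒯.extrapolatedNodes X p τ n) e ξ i -
      𝒯.tangent (𝒯.exactNodes X (n * τ)) e ξ i = ∑ a, lagrangeDeriv k a ξ i •
        -((fwdDiff τ)^[p] (X (𝒯.node (𝒯.nodeIndex e a))) s -
          (fwdDiff τ)^[p] (X (𝒯.vertex e 0)) s) := by
    rw [tangent_eq_sum, tangent_eq_sum, ← Finset.sum_sub_distrib]
    simp only [← smul_sub, 𝒯.extrapolatedNodes_sub_exactNodes p n, neg_sub]
    simp only [smul_sub, Finset.sum_sub_distrib, ← Finset.sum_smul, sum_lagrangeDeriv, zero_smul,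
      smul_neg, Finset.sum_neg_distrib, zero_sub, hs]
  rw [h1]
  refine norm_sum_lagrangeDeriv_smul_le (hK ξ hξ i) (by positivity) fun a => ?_
  obtain ⟨-, h2⟩ := 𝒯.node_bounds hk hC hloc e hd hdC hdρ a
  rw [norm_neg]
  refine (hdiff _ (𝒯.node_closest _).1 (by rw [dist_eq_norm]; linarith) τ s hτ.le hs0 hsT).trans ?_
  calc C * τ ^ p * ‖𝒯.node (𝒯.nodeIndex e a) - 𝒯.vertex e 0‖ ≤ C * τ ^ p * (2 * d) := by gcongr
    _ = _ := by ring

end Triangulation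

/-! ### Perturbation of the matrices -/

theorem abs_sum_setIntegral_sub_le {m : ℕ} {f g : Fin m → E2 → ℝ} {c : ℝ}
    (hf : ∀ e, ContinuousOn (f e) refTriangle) (hg : ∀ e, ContinuousOn (g e) refTriangle)
    (h : ∀ e, ∀ ξ ∈ refTriangle, |g e ξ - f e ξ| ≤ c * f e ξ) :
    |(∑ e, ∫ ξ in refTriangle, g e ξ) - ∑ e, ∫ ξ in refTriangle, f e ξ| ≤
      c * ∑ e, ∫ ξ in refTriangle, f e ξ := by
  rw [← Finset.sum_sub_distrib, Finset.mul_sum]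
  refine (Finset.abs_sum_le_sum_abs _ _).trans (Finset.sum_le_sum fun e _ => ?_)
  have hfi := (hf e).integrableOn_compact (μ := volume) isCompact_refTriangle
  have hgi := (hg e).integrableOn_compact (μ := volume) isCompact_refTriangle
  rw [← integral_sub hgi hfi, ← integral_const_mul]
  refine (abs_integral_le_integral_abs (μ := volume.restrict refTriangle)).trans ?_
  exact setIntegral_mono_on (hgi.sub hfi).abs (hfi.const_mul c)
    isCompact_refTriangle.measurableSet (h e)

/-- For a symmetric matrix `D`, a bound for its quadratic form by that of `B` extends to the bilinear
form: polarization of `D` and the parallelogram identity for `B` bound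
`2 t wᵀ D z` by `c (t² wᵀ B w + zᵀ B z)` for all `t`. -/
theorem dotProduct_mulVec_le_of_quadratic {ι : Type} [Fintype ι] {B D : Matrix ι ι ℝ} {c : ℝ}
    (hc : 0 ≤ c) (hD : D.IsSymm) (hB : ∀ w, 0 ≤ dotProduct w (B.mulVec w))
    (h : ∀ w, |dotProduct w (D.mulVec w)| ≤ c * dotProduct w (B.mulVec w)) (w z : ι → ℝ) :
    dotProduct w (D.mulVec z) ≤ c * matNorm B w * matNorm B z := by
  have hsymm : dotProduct z (D.mulVec w) = dotProduct w (D.mulVec z) := by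
    rw [Matrix.dotProduct_mulVec, ← Matrix.mulVec_transpose, hD.eq, dotProduct_comm]
  have hquad : ∀ t : ℝ, 0 ≤ c * dotProduct w (B.mulVec w) * (t * t) +
      (-2 * dotProduct w (D.mulVec z)) * t + c * dotProduct z (B.mulVec z) := by
    intro t
    have h1 := (abs_le.mp (h (t • w + z))).2
    have h2 := (abs_le.mp (h (t • w - z))).1
    simp only [Matrix.mulVec_add, Matrix.mulVec_sub, Matrix.mulVec_smul, dotProduct_add,
      dotProduct_sub, add_dotProduct, sub_dotProduct, smul_dotProduct, dotProduct_smul,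
      smul_eq_mul, hsymm] at h1 h2
    nlinarith
  have hdisc := discrim_le_zero hquad
  rw [discrim] at hdisc
  have hsq : (dotProduct w (D.mulVec z)) ^ 2 ≤ (c * matNorm B w * matNorm B z) ^ 2 := by
    rw [mul_pow, mul_pow, matNorm, matNorm, Real.sq_sqrt (hB w), Real.sq_sqrt (hB z)]
    nlinarith
  exact (abs_le_of_sq_le_sq' hsq
    (mul_nonneg (mul_nonneg hc (Real.sqrt_nonneg _)) (Real.sqrt_nonneg _))).2

namespace Triangulation

variable {Γ : Set E3} {k : ℕ} {𝒯 : Triangulation Γ k}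

theorem isSymm_massMatrix (x : Fin 𝒯.numNodes → E3) : (𝒯.massMatrix x).IsSymm := by
  ext i j
  simp [massMatrix, mul_comm]

theorem isSymm_stiffnessMatrix (x : Fin 𝒯.numNodes → E3) : (𝒯.stiffnessMatrix x).IsSymm := by
  ext i j
  simp [stiffnessMatrix, real_inner_comm]

theorem dotProduct_massMatrix_nonneg (x : Fin 𝒯.numNodes → E3) (w : Fin 𝒯.numNodes → ℝ) :
    0 ≤ dotProduct w ((𝒯.massMatrix x).mulVec w) := by
  rw [dotProduct_massMatrix]
  exact Finset.sum_nonneg fun e _ => integral_nonneg fun ξ =>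
    mul_nonneg (sq_nonneg _) (area_nonneg _ _)

theorem Nondegenerate.dotProduct_stiffnessMatrix_nonneg {x : Fin 𝒯.numNodes → E3}
    (hx : 𝒯.Nondegenerate x) (w : Fin 𝒯.numNodes → ℝ) :
    0 ≤ dotProduct w ((𝒯.stiffnessMatrix x).mulVec w) := by
  rw [hx.dotProduct_stiffnessMatrix]
  exact Finset.sum_nonneg fun e _ => integral_nonneg fun ξ => energyDensity_nonneg _ _ _

/-- On each element, the differential of the parametrization of `Γ_h[y]` is a perturbation of that of
`Γ_h[x]` of size `ε` relative to it. -/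
def IsRelPerturbation (𝒯 : Triangulation Γ k) (x y : Fin 𝒯.numNodes → E3) (ε : ℝ) : Prop :=
  ∀ e, ∀ ξ ∈ refTriangle, ∀ α β : ℝ,
    ‖(α • 𝒯.tangent y e ξ 0 + β • 𝒯.tangent y e ξ 1) -
      (α • 𝒯.tangent x e ξ 0 + β • 𝒯.tangent x e ξ 1)‖ ≤
      ε * ‖α • 𝒯.tangent x e ξ 0 + β • 𝒯.tangent x e ξ 1‖

theorem IsRelPerturbation.abs_massMatrix_sub_le {x y : Fin 𝒯.numNodes → E3} {ε : ℝ}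
    (h : 𝒯.IsRelPerturbation x y ε) (hε : 0 ≤ ε) (w : Fin 𝒯.numNodes → ℝ) :
    |dotProduct w ((𝒯.massMatrix y - 𝒯.massMatrix x).mulVec w)| ≤
      (2 * ε + ε ^ 2) * dotProduct w ((𝒯.massMatrix x).mulVec w) := by
  rw [Matrix.sub_mulVec, dotProduct_sub, dotProduct_massMatrix, dotProduct_massMatrix]
  refine abs_sum_setIntegral_sub_le
    (f := fun e ξ => 𝒯.pullback w e ξ ^ 2 * area (𝒯.tangent x e ξ 0) (𝒯.tangent x e ξ 1))
    (g := fun e ξ => 𝒯.pullback w e ξ ^ 2 * area (𝒯.tangent y e ξ 0) (𝒯.tangent y e ξ 1))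
    (fun e => (((𝒯.continuous_pullback w e).pow 2).mul (𝒯.continuous_area x e)).continuousOn)
    (fun e => (((𝒯.continuous_pullback w e).pow 2).mul (𝒯.continuous_area y e)).continuousOn)
    fun e ξ hξ => ?_
  rw [← mul_sub, abs_mul, abs_of_nonneg (sq_nonneg _), mul_left_comm]
  exact mul_le_mul_of_nonneg_left (abs_area_sub_le hε (h e ξ hξ)) (sq_nonneg _)

theorem IsRelPerturbation.nondegenerate {x y : Fin 𝒯.numNodes → E3} {ε : ℝ}
    (h : 𝒯.IsRelPerturbation x y ε) (hε : ε ≤ 1 / 2) (hx : 𝒯.Nondegenerate x) :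
    𝒯.Nondegenerate y :=
  fun e ξ hξ => area_pos_of_sub_le (hx e ξ hξ) hε (h e ξ hξ)

theorem IsRelPerturbation.abs_stiffnessMatrix_sub_le {x y : Fin 𝒯.numNodes → E3} {ε : ℝ}
    (h : 𝒯.IsRelPerturbation x y ε) (hε0 : 0 ≤ ε) (hε : ε ≤ 1 / 2) (hx : 𝒯.Nondegenerate x)
    (w : Fin 𝒯.numNodes → ℝ) :
    |dotProduct w ((𝒯.stiffnessMatrix y - 𝒯.stiffnessMatrix x).mulVec w)| ≤
      30 * ε * dotProduct w ((𝒯.stiffnessMatrix x).mulVec w) := by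
  have hy := h.nondegenerate hε hx
  rw [Matrix.sub_mulVec, dotProduct_sub, hx.dotProduct_stiffnessMatrix,
    hy.dotProduct_stiffnessMatrix]
  exact abs_sum_setIntegral_sub_le (fun e => hx.continuousOn_energyDensity e w)
    (fun e => hy.continuousOn_energyDensity e w)
    fun e ξ hξ => abs_energyDensity_sub_le (hx e ξ hξ) hε0 hε (h e ξ hξ) _

theorem dotProduct_kMatrix (α : ℝ) (x : Fin 𝒯.numNodes → E3)
    (w : Fin 3 × Fin 𝒯.numNodes → ℝ) :
    dotProduct w ((𝒯.kMatrix α x).mulVec w) =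
      ∑ c, (dotProduct (fun j => w (c, j)) ((𝒯.massMatrix x).mulVec fun j => w (c, j)) +
        α * dotProduct (fun j => w (c, j)) ((𝒯.stiffnessMatrix x).mulVec fun j => w (c, j))) := by
  have h : ∀ M : Matrix (Fin 𝒯.numNodes) (Fin 𝒯.numNodes) ℝ,
      dotProduct w ((Matrix.kronecker (1 : Matrix (Fin 3) (Fin 3) ℝ) M).mulVec w) =
        ∑ c, dotProduct (fun j => w (c, j)) (M.mulVec fun j => w (c, j)) := fun M => by
    simp only [dotProduct, Matrix.mulVec, Fintype.sum_prod_type]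
    refine Finset.sum_congr rfl fun c _ => Finset.sum_congr rfl fun i _ => ?_
    congr 1
    simp [Matrix.kronecker, Matrix.one_apply, ite_mul, Finset.sum_ite_irrel]
  rw [kMatrix, Matrix.add_mulVec, Matrix.smul_mulVec, dotProduct_add, dotProduct_smul, h, h,
    smul_eq_mul, Finset.mul_sum, ← Finset.sum_add_distrib]

theorem Nondegenerate.matNorm_kMatrix_sq {x : Fin 𝒯.numNodes → E3} (hx : 𝒯.Nondegenerate x)
    {α : ℝ} (hα : 0 ≤ α) (w : Fin 3 × Fin 𝒯.numNodes → ℝ) :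
    matNorm (𝒯.kMatrix α x) w ^ 2 = dotProduct w ((𝒯.kMatrix α x).mulVec w) := by
  rw [matNorm, Real.sq_sqrt]
  rw [dotProduct_kMatrix]
  exact Finset.sum_nonneg fun c _ => add_nonneg (dotProduct_massMatrix_nonneg x _)
    (mul_nonneg hα (hx.dotProduct_stiffnessMatrix_nonneg _))

theorem abs_kMatrix_sub_le {x y : Fin 𝒯.numNodes → E3} {c α : ℝ} (hα : 0 ≤ α)
    (hM : ∀ w, |dotProduct w ((𝒯.massMatrix y - 𝒯.massMatrix x).mulVec w)| ≤
      c * dotProduct w ((𝒯.massMatrix x).mulVec w))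
    (hA : ∀ w, |dotProduct w ((𝒯.stiffnessMatrix y - 𝒯.stiffnessMatrix x).mulVec w)| ≤
      c * dotProduct w ((𝒯.stiffnessMatrix x).mulVec w))
    (w : Fin 3 × Fin 𝒯.numNodes → ℝ) :
    |dotProduct w ((𝒯.kMatrix α y).mulVec w) - dotProduct w ((𝒯.kMatrix α x).mulVec w)| ≤
      c * dotProduct w ((𝒯.kMatrix α x).mulVec w) := by
  simp only [Matrix.sub_mulVec, dotProduct_sub] at hM hA
  rw [dotProduct_kMatrix, dotProduct_kMatrix, ← Finset.sum_sub_distrib, Finset.mul_sum]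
  refine (Finset.abs_sum_le_sum_abs _ _).trans (Finset.sum_le_sum fun i _ => ?_)
  rw [add_sub_add_comm, ← mul_sub, mul_add, mul_left_comm]
  refine (abs_add_le _ _).trans (add_le_add (hM _) ?_)
  rw [abs_mul, abs_of_nonneg hα]
  exact mul_le_mul_of_nonneg_left (hA _) hα

end Triangulation

/-! ### The relative perturbation caused by the extrapolation -/

/-- On fine meshes the exact surface `Γ_h[x_*ⁿ]` is nondegenerate, and extrapolation perturbs the
differentials of its parametrizations by `O(τ^p)` relatively, without a restriction on `τ`. -/
theorem exists_relPerturbation_bound {Γ : Set E3} (hΓ : IsSmoothClosedSurface Γ) {T : ℝ}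
    (hT : 0 < T) {X : E3 → ℝ → E3} (hX : IsSmoothEvolution Γ T X) {k : ℕ} (hk : 1 ≤ k) (p : ℕ)
    (σ : ℝ) :
    ∃ h₀ > (0 : ℝ), ∃ E : ℝ, 0 ≤ E ∧ ∀ 𝒯 : Triangulation Γ k, 𝒯.IsAdmissible σ →
      𝒯.meshWidth ≤ h₀ → ∀ (τ : ℝ) (n : ℕ), 0 < τ → p ≤ n → (n : ℝ) * τ ≤ T →
        𝒯.Nondegenerate (𝒯.exactNodes X (n * τ)) ∧
        𝒯.IsRelPerturbation (𝒯.exactNodes X (n * τ)) (𝒯.extrapolatedNodes X p τ n)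
          (E * τ ^ p) := by
  obtain ⟨ρ, hρ, C, hC, hloc⟩ := exists_localBounds hΓ hT hX p
  obtain ⟨K, hK0, hK⟩ := exists_bound_lagrangeDeriv k
  obtain ⟨σ', hσ', hσσ'⟩ : ∃ σ', 1 ≤ σ' ∧ σ ≤ σ' := ⟨max 1 σ, by simp, by simp⟩
  set D := 4 * σ' * (C ^ 2 + K * C ^ 2 * (4 + 2 * C)) with hD
  have hD0 : 0 < D := by positivity
  refine ⟨min (min (1 / (2 * C)) (ρ / 2)) (1 / D), by positivity, 8 * σ' * K * C ^ 2,
    by positivity, fun 𝒯 hadm hh τ n hτ hpn hnT => ?_⟩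
  have hlow : ∀ e, ∀ ξ ∈ refTriangle, ∀ α β : ℝ,
      Metric.diam (triangle (𝒯.vertex e)) * (|α| + |β|) ≤ 4 * σ' * C *
        ‖α • 𝒯.tangent (𝒯.exactNodes X (n * τ)) e ξ 0 +
          β • 𝒯.tangent (𝒯.exactNodes X (n * τ)) e ξ 1‖ ∧
      ∀ i, ‖𝒯.tangent (𝒯.extrapolatedNodes X p τ n) e ξ i -
        𝒯.tangent (𝒯.exactNodes X (n * τ)) e ξ i‖ ≤
          K * (2 * C * τ ^ p * Metric.diam (triangle (𝒯.vertex e))) := by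
    intro e ξ hξ α β
    have hd := (𝒯.diam_le_meshWidth e).trans hh
    have h1 : 2 * C * Metric.diam (triangle (𝒯.vertex e)) ≤ 1 := by
      have := hd.trans ((min_le_left _ _).trans (min_le_left _ _))
      rwa [le_div_iff₀ (by positivity), mul_comm] at this
    have h2 : 2 * Metric.diam (triangle (𝒯.vertex e)) ≤ ρ := by
      linarith [hd.trans ((min_le_left _ _).trans (min_le_right _ _))]
    have h3 : D * Metric.diam (triangle (𝒯.vertex e)) ≤ 1 := by
      have := hd.trans (min_le_right _ _)
      rwa [le_div_iff₀ hD0, mul_comm] at this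
    have hr : 0 ≤ inradius (𝒯.vertex e) := by unfold inradius; positivity
    exact ⟨𝒯.diam_mul_le_norm_tangent hk hC hloc hσ' hK e rfl
        ((hadm.shapeRegular e).trans (by gcongr)) h1 h2 h3 ⟨by positivity, hnT⟩ hξ α β,
      fun i => 𝒯.norm_tangent_sub_le hk hC hloc hK e rfl h1 h2 hτ hpn hnT hξ i⟩
  constructor
  · intro e ξ hξ
    have hd0 := diam_triangle_pos (𝒯.affineIndependent e)
    by_contra hc
    have hA : area (𝒯.tangent (𝒯.exactNodes X (n * τ)) e ξ 0)
        (𝒯.tangent (𝒯.exactNodes X (n * τ)) e ξ 1) = 0 :=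
      le_antisymm (not_lt.mp hc) (area_nonneg _ _)
    exact absurd hA (area_ne_zero fun α β h0 => by
      have := (hlow e ξ hξ α β).1
      rw [h0, norm_zero, mul_zero] at this
      have hs : |α| + |β| ≤ 0 := by
        by_contra hcs
        nlinarith [mul_pos hd0 (not_le.mp hcs)]
      exact ⟨abs_nonpos_iff.mp (by linarith [abs_nonneg β]),
        abs_nonpos_iff.mp (by linarith [abs_nonneg α])⟩)
  · intro e ξ hξ α β
    obtain ⟨h1, h2⟩ := hlow e ξ hξ α β
    set a := 𝒯.tangent (𝒯.exactNodes X (n * τ)) e ξ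
    set a' := 𝒯.tangent (𝒯.extrapolatedNodes X p τ n) e ξ
    set d := Metric.diam (triangle (𝒯.vertex e))
    have h3 : (α • a' 0 + β • a' 1) - (α • a 0 + β • a 1) =
        α • (a' 0 - a 0) + β • (a' 1 - a 1) := by module
    rw [h3]
    calc ‖α • (a' 0 - a 0) + β • (a' 1 - a 1)‖
        ≤ |α| * (K * (2 * C * τ ^ p * d)) + |β| * (K * (2 * C * τ ^ p * d)) := by
          refine (norm_add_le _ _).trans ?_
          rw [norm_smul, norm_smul, Real.norm_eq_abs, Real.norm_eq_abs]
          gcongr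
          · exact h2 0
          · exact h2 1
      _ = 2 * K * C * τ ^ p * (d * (|α| + |β|)) := by ring
      _ ≤ 2 * K * C * τ ^ p * (4 * σ' * C * ‖α • a 0 + β • a 1‖) := by gcongr
      _ = _ := by ring

end ESFEM

theorem lemma4p3 (Γ : Set ESFEM.E3) (hΓ : ESFEM.IsSmoothClosedSurface Γ)
    (T : ℝ) (hT : 0 < T) (X : ESFEM.E3 → ℝ → ESFEM.E3) (hX : ESFEM.IsSmoothEvolution Γ T X)
    (k : ℕ) (hk : 1 ≤ k) (p : ℕ) (hp : 1 ≤ p) (σ : ℝ) :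
    ∃ h₀ > (0 : ℝ), ∃ τ₀ > (0 : ℝ), ∃ C : ℝ,
      ∀ 𝒯 : ESFEM.Triangulation Γ k, 𝒯.IsAdmissible σ → 𝒯.meshWidth ≤ h₀ →
      ∀ (τ : ℝ) (n : ℕ), 0 < τ → p ≤ n → (n : ℝ) * τ ≤ T →
        (∀ w z : Fin 𝒯.numNodes → ℝ,
          dotProduct w ((𝒯.massMatrix (𝒯.extrapolatedNodes X p τ n) -
              𝒯.massMatrix (𝒯.exactNodes X ((n : ℝ) * τ))).mulVec z) ≤
            C * τ ^ p * ESFEM.matNorm (𝒯.massMatrix (𝒯.exactNodes X ((n : ℝ) * τ))) w *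
              ESFEM.matNorm (𝒯.massMatrix (𝒯.exactNodes X ((n : ℝ) * τ))) z) ∧
        (τ ≤ τ₀ →
          (∀ w z : Fin 𝒯.numNodes → ℝ,
            dotProduct w ((𝒯.stiffnessMatrix (𝒯.extrapolatedNodes X p τ n) -
                𝒯.stiffnessMatrix (𝒯.exactNodes X ((n : ℝ) * τ))).mulVec z) ≤
              C * τ ^ p * ESFEM.matNorm (𝒯.stiffnessMatrix (𝒯.exactNodes X ((n : ℝ) * τ))) w *
                ESFEM.matNorm (𝒯.stiffnessMatrix (𝒯.exactNodes X ((n : ℝ) * τ))) z) ∧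
          (∀ α : ℝ, 0 ≤ α → ∀ w : Fin 3 × Fin 𝒯.numNodes → ℝ,
            1 / 2 * ESFEM.matNorm (𝒯.kMatrix α (𝒯.exactNodes X ((n : ℝ) * τ))) w ^ 2 ≤
                ESFEM.matNorm (𝒯.kMatrix α (𝒯.extrapolatedNodes X p τ n)) w ^ 2 ∧
              ESFEM.matNorm (𝒯.kMatrix α (𝒯.extrapolatedNodes X p τ n)) w ^ 2 ≤
                3 / 2 * ESFEM.matNorm (𝒯.kMatrix α (𝒯.exactNodes X ((n : ℝ) * τ))) w ^ 2)) := by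
  obtain ⟨h₀, hh₀, E, hE, hmain⟩ := ESFEM.exists_relPerturbation_bound hΓ hT hX hk p σ
  obtain ⟨C, hC⟩ : ∃ C, C = 2 * E + E ^ 2 * T ^ p + 30 * E := ⟨_, rfl⟩
  have hET : 0 ≤ E ^ 2 * T ^ p := by positivity
  have hC0 : 0 ≤ C := by rw [hC]; positivity
  refine ⟨h₀, hh₀, min 1 (1 / (2 * (C + 1))), by positivity, C,
    fun 𝒯 hadm hh τ n hτ hpn hnT => ?_⟩
  obtain ⟨hx, hpert⟩ := hmain 𝒯 hadm hh τ n hτ hpn hnT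
  have hτT : τ ≤ T := by
    have h1 : (1 : ℝ) ≤ n := by exact_mod_cast hp.trans hpn
    nlinarith
  have hτp : τ ^ p ≤ T ^ p := by gcongr
  have hτp0 : 0 ≤ τ ^ p := by positivity
  have hCM : 2 * (E * τ ^ p) + (E * τ ^ p) ^ 2 ≤ C * τ ^ p := by
    have : (E * τ ^ p) ^ 2 ≤ E ^ 2 * T ^ p * τ ^ p := by
      rw [mul_pow, sq (τ ^ p), ← mul_assoc]
      gcongr
    rw [hC]
    nlinarith [mul_nonneg hE hτp0]
  have hM : ∀ w, |dotProduct w ((𝒯.massMatrix (𝒯.extrapolatedNodes X p τ n) -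
      𝒯.massMatrix (𝒯.exactNodes X ((n : ℝ) * τ))).mulVec w)| ≤
      C * τ ^ p * dotProduct w ((𝒯.massMatrix (𝒯.exactNodes X ((n : ℝ) * τ))).mulVec w) :=
    fun w => (hpert.abs_massMatrix_sub_le (by positivity) w).trans
      (mul_le_mul_of_nonneg_right hCM (ESFEM.Triangulation.dotProduct_massMatrix_nonneg _ w))
  refine ⟨ESFEM.dotProduct_mulVec_le_of_quadratic (by positivity)
    ((ESFEM.Triangulation.isSymm_massMatrix _).sub (ESFEM.Triangulation.isSymm_massMatrix _))
    (ESFEM.Triangulation.dotProduct_massMatrix_nonneg _) hM, fun hτ₀ => ?_⟩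
  have hCτ : C * τ ^ p ≤ 1 / 2 := by
    have h1 : τ ^ p ≤ τ := pow_le_of_le_one hτ.le (hτ₀.trans (min_le_left _ _)) (by omega)
    have h2 : τ ^ p ≤ 1 / (2 * (C + 1)) := h1.trans (hτ₀.trans (min_le_right _ _))
    rw [le_div_iff₀ (by positivity)] at h2
    nlinarith
  have hEC : 30 * (E * τ ^ p) ≤ C * τ ^ p := by
    rw [hC]
    nlinarith [mul_nonneg hE hτp0, mul_nonneg hET hτp0]
  have hEτ : E * τ ^ p ≤ 1 / 2 := by nlinarith [mul_nonneg hE hτp0]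
  have hA : ∀ w, |dotProduct w ((𝒯.stiffnessMatrix (𝒯.extrapolatedNodes X p τ n) -
      𝒯.stiffnessMatrix (𝒯.exactNodes X ((n : ℝ) * τ))).mulVec w)| ≤
      C * τ ^ p * dotProduct w ((𝒯.stiffnessMatrix (𝒯.exactNodes X ((n : ℝ) * τ))).mulVec w) :=
    fun w => (hpert.abs_stiffnessMatrix_sub_le (by positivity) hEτ hx w).trans
      (mul_le_mul_of_nonneg_right hEC (hx.dotProduct_stiffnessMatrix_nonneg w))
  refine ⟨ESFEM.dotProduct_mulVec_le_of_quadratic (by positivity)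
    ((ESFEM.Triangulation.isSymm_stiffnessMatrix _).sub
      (ESFEM.Triangulation.isSymm_stiffnessMatrix _))
    hx.dotProduct_stiffnessMatrix_nonneg hA, fun α hα w => ?_⟩
  have hy := hpert.nondegenerate hEτ hx
  have hK := abs_le.mp (ESFEM.Triangulation.abs_kMatrix_sub_le hα hM hA w)
  rw [← hx.matNorm_kMatrix_sq hα, ← hy.matNorm_kMatrix_sq hα] at hK
  have hhalf : C * τ ^ p * ESFEM.matNorm (𝒯.kMatrix α (𝒯.exactNodes X ((n : ℝ) * τ))) w ^ 2 ≤
      1 / 2 * ESFEM.matNorm (𝒯.kMatrix α (𝒯.exactNodes X ((n : ℝ) * τ))) w ^ 2 := by gcongr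
  constructor <;> linarith [hK.1, hK.2]
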